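/- **Theorem (Jackson-type estimate for $E^{\alpha}_{m,n}(f)$).** Equip $\mathcal C([-1,1]^2,\mathbb R)$ with the uniform norm $\|\cdot\|_\infty$. *Setting.* Let $N,M\ge 2$, let $-1=x_0<x_1<\dots<x_N=1$ and $-1=y_0<y_1<\dots<y_M=1$ be a net $\Delta$, and put $I_i=[x_{i-1},x_i]$, $J_j=[y_{j-1},y_j]$. Let $u_i:[-1,1]\to I_i$ be the affine bijection that is increasing for odd $i$ and decreasing for even $i$, and let $v_j:[-1,1]\to J_j$ be defined likewise. Let $\alpha\in\mathcal C([-1,1]^2,\mathbb R)$ with $\|\alpha\|_\infty<1$, and let $L$ be a bounded linear operator on $\mathcal C([-1,1]^2,\mathbb R)$ such that $(Lg)(x,y)=g(x,y)$ for every $g$ and every $x,y\in\{-1,1\}$; write $\|L\|$, $\|Id-L\|$ for operator norms. For $g\in\mathcal C([-1,1]^2,\mathbb R)$, the fractal function $g^\alpha=\mathcal F^\alpha_{\Delta,L}(g)$ is the unique continuous function that agrees with $g$ at all $(x_i,y_j)$ and whose graph $G$ satisfies $G=\bigcup_{i,j}W_{ij}(G)$, where $$W_{ij}(x,y,z)=\big(u_i(x),v_j(y),\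 \alpha(u_i(x),v_j(y))\,z+g(u_i(x),v_j(y))-\alpha(u_i(x),v_j(y))\,(Lg)(x,y)\big).$$ For $m,n\ge1$ let $\mathcal P_{m,n}$ be either the set of all polynomials $\sum_{i=0}^m\sum_{j=0}^n a_{ij}x^iy^j$ with real coefficients, or the set of all real bivariate polynomials of total degree at most $m+n$, both regarded as functions on $[-1,1]^2$; the estimate holds for each of the two choices. Put $$E^{\alpha}_{m,n}(f)=\inf\{\|f-p^\alpha\|_\infty: p\in\mathcal P_{m,n}\}.$$ With $\phi(x)=\sqrt{1-x^2}$, the Ditzian–Totik modulus of smoothness is $$\omega_2^\phi(f;\delta_1,\delta_2)=\sup_{0<h_1\le\delta_1,\;0<h_2\le\delta_2}\ \sup_{(x,y)\in[-1,1]^2}\Big|\sum_{k=0}^{2}(-1)^k\tbinom2k f\big(x+h_1\phi(x)(1-k),\,y+h_2\phi(y)(1-k)\big)\Big|,$$ where the difference is taken to be $0$ unless $x\pm h_1\phi(x)\in[-1,1]$ and $y\pm h_2\phi(y)\in[-1,1]$. *Claim.* There is an absolute constant $C>0$ (independent of $f,m,n,\Delta,\alpha,L$) such that, in every such setting, for all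 $f\in\mathcal C([-1,1]^2,\mathbb R)$ and all integers $m,n\ge 1$, $$E^{\alpha}_{m,n}(f)\le C\,\frac{1+\|\alpha\|_\infty\big(\|Id-L\|-1\big)}{1-\|\alpha\|_\infty}\,\omega_2^{\phi}\Big(f;\frac1m,\frac1n\Big)+\frac{\|\alpha\|_\infty\|Id-L\|}{1-\|\alpha\|_\infty}\,\|f\|_\infty .$$ -/

import Mathlib

namespace BivariateFractal

noncomputable section

/-- The interval `[-1, 1]`. -/
abbrev Segment : Type := Set.Icc (-1 : ℝ) 1

/-- The square `[-1, 1]²`; `C(Square, ℝ)` carries the uniform norm. -/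
abbrev Square : Type := Segment × Segment

/-- A partition `-1 = x₀ < x₁ < ⋯ < x_N = 1` with `N ≥ 2`
(`N ≥ 2` is what makes the affine maps onto the subintervals contractive). -/
structure Grid where
  N : ℕ
  two_le : 2 ≤ N
  node : Fin (N + 1) → Segment
  strictMono : StrictMono node
  node_zero : (node 0 : ℝ) = -1
  node_last : (node (Fin.last N) : ℝ) = 1

namespace Grid

variable (P : Grid)

/-- Left end point of the `i`-th subinterval. The index `i : Fin N` starts at `0`, so it stands
for the subinterval usually numbered `i + 1`. -/
def lo (i : Fin P.N) : ℝ := P.node i.castSucc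

/-- Right end point of the `i`-th subinterval. -/
def hi (i : Fin P.N) : ℝ := P.node i.succ

lemma lo_lt_hi (i : Fin P.N) : P.lo i < P.hi i :=
  P.strictMono i.castSucc_lt_succ

/-- The affine homeomorphism of `[-1, 1]` onto the `i`-th subinterval: increasing on the first,
third, fifth, ... subinterval and decreasing on the others. -/
def cellMap (i : Fin P.N) (x : Segment) : Segment :=
  ⟨if Even (i : ℕ) then P.lo i + (x + 1) / 2 * (P.hi i - P.lo i)
    else P.hi i - (x + 1) / 2 * (P.hi i - P.lo i), by
    have h := P.lo_lt_hi i
    have h1 : -1 ≤ P.lo i := (P.node i.castSucc).2.1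
    have h2 : P.hi i ≤ 1 := (P.node i.succ).2.2
    have hx1 := x.2.1
    have hx2 := x.2.2
    split_ifs <;> constructor <;> nlinarith⟩

lemma lo_le_cellMap (i : Fin P.N) (x : Segment) : P.lo i ≤ P.cellMap i x := by
  have h := P.lo_lt_hi i
  have hx1 := x.2.1
  have hx2 := x.2.2
  simp only [cellMap]
  split_ifs <;> nlinarith

lemma cellMap_le_hi (i : Fin P.N) (x : Segment) : P.cellMap i x ≤ P.hi i := by
  have h := P.lo_lt_hi i
  have hx1 := x.2.1
  have hx2 := x.2.2
  simp only [cellMap]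
  split_ifs <;> nlinarith

lemma cellMap_injective (i : Fin P.N) {x y : Segment} (hxy : P.cellMap i x = P.cellMap i y) :
    x = y := by
  have h := sub_pos.2 (P.lo_lt_hi i)
  have hc := congrArg Subtype.val hxy
  simp only [cellMap] at hc
  apply Subtype.ext
  split_ifs at hc <;> (apply mul_right_cancel₀ h.ne'; linarith)

lemma continuous_cellMap (i : Fin P.N) : Continuous (P.cellMap i) := by
  apply Continuous.subtype_mk
  by_cases h : Even (i : ℕ)
  · simp only [h, if_true]; fun_prop
  · simp only [h, if_false]; fun_prop

/-- Each point of a subinterval is in the range of its affine map. -/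
lemma exists_cellMap_eq (i : Fin P.N) (t : Segment) (h1 : P.lo i ≤ t) (h2 : (t : ℝ) ≤ P.hi i) :
    ∃ x, P.cellMap i x = t := by
  have h := sub_pos.2 (P.lo_lt_hi i)
  by_cases he : Even (i : ℕ)
  · refine ⟨⟨2 * ((t - P.lo i) / (P.hi i - P.lo i)) - 1, ?_, ?_⟩, Subtype.ext ?_⟩
    · have : 0 ≤ (t - P.lo i) / (P.hi i - P.lo i) := div_nonneg (by linarith) h.le
      linarith
    · have : (t - P.lo i) / (P.hi i - P.lo i) ≤ 1 := by rw [div_le_one h]; linarith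
      linarith
    · simp only [cellMap, he, if_true]
      field_simp
      ring
  · refine ⟨⟨2 * ((P.hi i - t) / (P.hi i - P.lo i)) - 1, ?_, ?_⟩, Subtype.ext ?_⟩
    · have : 0 ≤ (P.hi i - t) / (P.hi i - P.lo i) := div_nonneg (by linarith) h.le
      linarith
    · have : (P.hi i - t) / (P.hi i - P.lo i) ≤ 1 := by rw [div_le_one h]; linarith
      linarith
    · simp only [cellMap, he, if_false]
      field_simp
      ring

lemma cellMap_surjective (t : Segment) : ∃ i x, P.cellMap i x = t := by
  classical
  have hN := P.two_le
  by_cases hex : ∃ i : Fin P.N, (t : ℝ) ≤ P.hi i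
  · have hne : (Finset.univ.filter fun i : Fin P.N => (t : ℝ) ≤ P.hi i).Nonempty := by
      obtain ⟨i, hi⟩ := hex
      exact ⟨i, by simpa using hi⟩
    obtain ⟨i, hi, hmin⟩ := Finset.exists_min_image _ (fun i => i) hne
    have hi' : (t : ℝ) ≤ P.hi i := by simpa using hi
    refine ⟨i, P.exists_cellMap_eq i t ?_ hi'⟩
    by_contra hlt
    push Not at hlt
    rcases Nat.eq_zero_or_pos (i : ℕ) with h0 | hpos
    · have : i.castSucc = 0 := Fin.ext (by simpa using h0)
      rw [lo, this, P.node_zero] at hlt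
      exact absurd t.2.1 (not_le.2 hlt)
    · have hm := hmin ⟨(i : ℕ) - 1, by omega⟩ (by
        simp only [Finset.mem_filter, Finset.mem_univ, true_and]
        have : (⟨(i : ℕ) - 1, by omega⟩ : Fin P.N).succ = i.castSucc :=
          Fin.ext (by simp; omega)
        rw [Grid.hi, this]
        exact hlt.le)
      have : (i : ℕ) ≤ (i : ℕ) - 1 := hm
      omega
  · push Not at hex
    have := hex ⟨P.N - 1, by omega⟩
    have hs : (⟨P.N - 1, by omega⟩ : Fin P.N).succ = Fin.last P.N :=
      Fin.ext (by simp; omega)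
    rw [Grid.hi, hs, P.node_last] at this
    exact absurd t.2.2 (not_le.2 this)

/-- Consecutive affine maps agree, as to preimages, at the common node. -/
lemma cellMap_eq_of_lt {i j : Fin P.N} (hij : i < j) {x y : Segment}
    (h : P.cellMap i x = P.cellMap j y) : x = y := by
  have hc : (P.cellMap i x : ℝ) = P.cellMap j y := congrArg Subtype.val h
  have h1 := P.cellMap_le_hi i x
  have h2 := P.lo_le_cellMap j y
  have hle : P.node i.succ ≤ P.node j.castSucc :=
    P.strictMono.monotone (by rw [Fin.le_def]; simpa using hij)
  have hle' : P.hi i ≤ P.lo j := hle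
  have e1 : (P.cellMap i x : ℝ) = P.hi i := by linarith
  have e2 : (P.cellMap j y : ℝ) = P.lo j := by linarith
  have hnode : P.node i.succ = P.node j.castSucc := Subtype.ext (by
    change P.hi i = P.lo j
    linarith)
  have hval := congrArg Fin.val (P.strictMono.injective hnode)
  simp only [Fin.val_succ, Fin.val_castSucc] at hval
  have hi := sub_pos.2 (P.lo_lt_hi i)
  have hj := sub_pos.2 (P.lo_lt_hi j)
  have hpar : Even (j : ℕ) ↔ ¬ Even (i : ℕ) := by rw [← hval, Nat.even_add_one]
  apply Subtype.ext
  simp only [cellMap] at e1 e2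
  by_cases he : Even (i : ℕ)
  · rw [if_pos he] at e1
    rw [if_neg (by rw [hpar]; exact not_not.2 he)] at e2
    have a : ((x : ℝ) + 1) / 2 = 1 := mul_right_cancel₀ hi.ne' (by linarith)
    have b : ((y : ℝ) + 1) / 2 = 1 := mul_right_cancel₀ hj.ne' (by linarith)
    linarith
  · rw [if_neg he] at e1
    rw [if_pos (hpar.2 he)] at e2
    have a : ((x : ℝ) + 1) / 2 = 0 := mul_right_cancel₀ hi.ne' (by linarith)
    have b : ((y : ℝ) + 1) / 2 = 0 := mul_right_cancel₀ hj.ne' (by linarith)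
    linarith

/-- The inverses of the affine maps glue to one continuous map of `[-1, 1]`. -/
lemma exists_fold : ∃ σ : C(Segment, Segment), ∀ i x, σ (P.cellMap i x) = x := by
  let U : Fin P.N × Segment → Segment := fun q => P.cellMap q.1 q.2
  have hU : Continuous U := by
    rw [continuous_prod_of_discrete_left]
    exact P.continuous_cellMap
  have hq : Topology.IsQuotientMap U :=
    hU.isClosedMap.isQuotientMap hU (fun t => by
      obtain ⟨i, x, h⟩ := P.cellMap_surjective t
      exact ⟨(i, x), h⟩)
  have hUq : Topology.IsQuotientMap (⟨U, hU⟩ : C(Fin P.N × Segment, Segment)) := hq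
  have hwd : ∀ a b : Fin P.N × Segment, U a = U b → a.2 = b.2 := by
    rintro ⟨i, x⟩ ⟨j, y⟩ h
    rcases lt_trichotomy i j with hij | hij | hij
    · exact P.cellMap_eq_of_lt hij h
    · subst hij
      exact P.cellMap_injective i h
    · exact (P.cellMap_eq_of_lt hij h.symm).symm
  refine ⟨hUq.lift ⟨Prod.snd, continuous_snd⟩ (fun a b h => hwd a b h), fun i x => ?_⟩
  have := DFunLike.congr_fun
    (hUq.lift_comp ⟨Prod.snd, continuous_snd⟩ (fun a b h => hwd a b h)) (i, x)
  exact this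

/-- An end point of `[-1, 1]`. -/
def endpoint (b : Bool) : Segment := if b then ⟨1, by norm_num⟩ else ⟨-1, by norm_num⟩

/-- Every node is the image of an end point of `[-1, 1]`. -/
lemma exists_cellMap_endpoint (k : Fin (P.N + 1)) :
    ∃ i b, P.cellMap i (endpoint b) = P.node k := by
  have hN := P.two_le
  have key : ∀ i : Fin P.N, (∃ b, P.cellMap i (endpoint b) = P.node i.castSucc) ∧
      ∃ b, P.cellMap i (endpoint b) = P.node i.succ := by
    intro i
    by_cases he : Even (i : ℕ)
    · refine ⟨⟨false, Subtype.ext ?_⟩, ⟨true, Subtype.ext ?_⟩⟩ <;>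
        simp [cellMap, he, endpoint, lo, hi]
    · refine ⟨⟨true, Subtype.ext ?_⟩, ⟨false, Subtype.ext ?_⟩⟩ <;>
        simp [cellMap, he, endpoint, lo, hi]
  by_cases hk : (k : ℕ) < P.N
  · obtain ⟨b, hb⟩ := (key ⟨k, hk⟩).1
    exact ⟨_, b, hb⟩
  · have hk2 := k.2
    obtain ⟨b, hb⟩ := (key ⟨P.N - 1, by omega⟩).2
    refine ⟨_, b, hb.trans (congrArg _ (Fin.ext ?_))⟩
    simp
    omega

lemma exists_node_eq_endpoint (b : Bool) : ∃ k, P.node k = endpoint b := by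
  cases b
  · exact ⟨0, Subtype.ext (by simp [P.node_zero, endpoint])⟩
  · exact ⟨Fin.last _, Subtype.ext (by simp [P.node_last, endpoint])⟩

end Grid

/-- `L f` agrees with `f` at the four corners of the square, for every `f`. -/
def InterpolatesCorners (L : C(Square, ℝ) →L[ℝ] C(Square, ℝ)) : Prop :=
  ∀ (f : C(Square, ℝ)) (p : Square), ((p.1 : ℝ) = -1 ∨ (p.1 : ℝ) = 1) →
    ((p.2 : ℝ) = -1 ∨ (p.2 : ℝ) = 1) → L f p = f p

/-- The map `(x, y) ↦ (u_i(x), v_j(y))` of the square onto the cell with index `(i, j)`. -/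
def cell (X Y : Grid) (i : Fin X.N) (j : Fin Y.N) (p : Square) : Square :=
  (X.cellMap i p.1, Y.cellMap j p.2)

/-- `F_ij(x, y, z) = α(u_i x, v_j y) z + f(u_i x, v_j y) - α(u_i x, v_j y) (L f)(x, y)`. -/
def ifsHeight (X Y : Grid) (α : C(Square, ℝ)) (L : C(Square, ℝ) →L[ℝ] C(Square, ℝ))
    (f : C(Square, ℝ)) (i : Fin X.N) (j : Fin Y.N) (p : Square) (z : ℝ) : ℝ :=
  α (cell X Y i j p) * z + f (cell X Y i j p) - α (cell X Y i j p) * L f p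

/-- The maps `W_ij(x, y, z) = (u_i(x), v_j(y), F_ij(x, y, z))` of the iterated function system. -/
def ifsMap (X Y : Grid) (α : C(Square, ℝ)) (L : C(Square, ℝ) →L[ℝ] C(Square, ℝ))
    (f : C(Square, ℝ)) (i : Fin X.N) (j : Fin Y.N) (q : Square × ℝ) : Square × ℝ :=
  (cell X Y i j q.1, ifsHeight X Y α L f i j q.1 q.2)

/-- The graph of `g`. -/
def graph (g : C(Square, ℝ)) : Set (Square × ℝ) := Set.range fun p => (p, g p)

/-- `g` is an `α`-fractal function of `f`: it interpolates `f` at all the nodes of the net, and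
its graph is the union of its images under the maps of the iterated function system. -/
def IsAlphaFractal (X Y : Grid) (α : C(Square, ℝ)) (L : C(Square, ℝ) →L[ℝ] C(Square, ℝ))
    (f g : C(Square, ℝ)) : Prop :=
  (∀ i j, g (X.node i, Y.node j) = f (X.node i, Y.node j)) ∧
    graph g = ⋃ (i : Fin X.N) (j : Fin Y.N), ifsMap X Y α L f i j '' graph g

lemma graph_eq_iff (X Y : Grid) (α : C(Square, ℝ)) (L : C(Square, ℝ) →L[ℝ] C(Square, ℝ))
    (f g : C(Square, ℝ)) :
    (graph g = ⋃ (i : Fin X.N) (j : Fin Y.N), ifsMap X Y α L f i j '' graph g) ↔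
      ∀ i j p, g (cell X Y i j p) = ifsHeight X Y α L f i j p (g p) := by
  constructor
  · intro h i j p
    have hm : ifsMap X Y α L f i j (p, g p) ∈ graph g := by
      rw [h]
      exact Set.mem_iUnion₂.2 ⟨i, j, _, ⟨p, rfl⟩, rfl⟩
    obtain ⟨q, hq⟩ := hm
    simp only [ifsMap, Prod.mk.injEq] at hq
    obtain ⟨h1, h2⟩ := hq
    rw [← h1, h2]
  · intro h
    ext q
    simp only [Set.mem_iUnion]
    constructor
    · rintro ⟨⟨s, t⟩, rfl⟩
      obtain ⟨i, x, rfl⟩ := X.cellMap_surjective s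
      obtain ⟨j, y, rfl⟩ := Y.cellMap_surjective t
      exact ⟨i, j, _, ⟨(x, y), rfl⟩, Prod.ext rfl (h i j (x, y)).symm⟩
    · rintro ⟨i, j, _, ⟨p, rfl⟩, rfl⟩
      exact ⟨cell X Y i j p, Prod.ext rfl (h i j p)⟩

theorem existsUnique_isAlphaFractal (X Y : Grid) (α : C(Square, ℝ))
    (L : C(Square, ℝ) →L[ℝ] C(Square, ℝ)) (hα : ‖α‖ < 1) (hL : InterpolatesCorners L)
    (f : C(Square, ℝ)) : ∃! g, IsAlphaFractal X Y α L f g := by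
  obtain ⟨σ, hσ⟩ := X.exists_fold
  obtain ⟨τ, hτ⟩ := Y.exists_fold
  let S : C(Square, Square) := σ.prodMap τ
  have hS : ∀ i j p, S (cell X Y i j p) = p := fun i j p => Prod.ext (hσ i p.1) (hτ j p.2)
  let T : C(Square, ℝ) → C(Square, ℝ) := fun g => f + α * (g - L f).comp S
  have hT : ContractingWith ⟨‖α‖, norm_nonneg α⟩ T := by
    refine ⟨by exact_mod_cast hα, LipschitzWith.of_dist_le_mul fun g h => ?_⟩
    change dist (T g) (T h) ≤ ‖α‖ * dist g h
    rw [ContinuousMap.dist_le (by positivity)]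
    intro p
    have e : T g p - T h p = α p * (g (S p) - h (S p)) := by simp [T]; ring
    rw [Real.dist_eq, e, abs_mul]
    exact mul_le_mul (α.norm_coe_le_norm p)
      ((Real.dist_eq _ _).symm.le.trans (ContinuousMap.dist_apply_le_dist _))
      (abs_nonneg _) (norm_nonneg _)
  have hfix : ∀ g, (∀ i j p, g (cell X Y i j p) = ifsHeight X Y α L f i j p (g p)) ↔
      Function.IsFixedPt T g := by
    intro g
    constructor
    · intro h
      ext ⟨s, t⟩
      obtain ⟨i, x, rfl⟩ := X.cellMap_surjective s
      obtain ⟨j, y, rfl⟩ := Y.cellMap_surjective t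
      have h1 := h i j (x, y)
      have h2 := hS i j (x, y)
      change T g (cell X Y i j (x, y)) = g (cell X Y i j (x, y))
      simp only [T, ContinuousMap.add_apply, ContinuousMap.mul_apply, ContinuousMap.comp_apply,
        ContinuousMap.sub_apply, h2, h1, ifsHeight]
      ring
    · intro h i j p
      have h1 := DFunLike.congr_fun h (cell X Y i j p)
      have h2 := hS i j p
      simp only [T, ContinuousMap.add_apply, ContinuousMap.mul_apply, ContinuousMap.comp_apply,
        ContinuousMap.sub_apply, h2] at h1
      rw [← h1, ifsHeight]
      ring
  refine ⟨hT.fixedPoint T, ⟨?_, ?_⟩, ?_⟩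
  · set g := hT.fixedPoint T
    have hg := (hfix g).2 hT.fixedPoint_isFixedPt
    have hcor : ∀ a b, L f (Grid.endpoint a, Grid.endpoint b) =
        f (Grid.endpoint a, Grid.endpoint b) := by
      intro a b
      apply hL
      · cases a <;> simp [Grid.endpoint]
      · cases b <;> simp [Grid.endpoint]
    let d : Bool × Bool → ℝ := fun c => |g (Grid.endpoint c.1, Grid.endpoint c.2) -
      f (Grid.endpoint c.1, Grid.endpoint c.2)|
    have hnode : ∀ k l, ∃ c, |g (X.node k, Y.node l) - f (X.node k, Y.node l)| ≤ ‖α‖ * d c := by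
      intro k l
      obtain ⟨i, a, ha⟩ := X.exists_cellMap_endpoint k
      obtain ⟨j, b, hb⟩ := Y.exists_cellMap_endpoint l
      have h1 := hg i j (Grid.endpoint a, Grid.endpoint b)
      have h2 : cell X Y i j (Grid.endpoint a, Grid.endpoint b) = (X.node k, Y.node l) :=
        Prod.ext ha hb
      rw [ifsHeight, h2, hcor] at h1
      refine ⟨(a, b), ?_⟩
      have e : g (X.node k, Y.node l) - f (X.node k, Y.node l) = α (X.node k, Y.node l) *
          (g (Grid.endpoint a, Grid.endpoint b) - f (Grid.endpoint a, Grid.endpoint b)) := by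
        rw [h1]; ring
      rw [e, abs_mul]
      exact mul_le_mul_of_nonneg_right (α.norm_coe_le_norm _) (abs_nonneg _)
    obtain ⟨c, hc⟩ := Finite.exists_max d
    have hd : d c ≤ 0 := by
      obtain ⟨k, hk⟩ := X.exists_node_eq_endpoint c.1
      obtain ⟨l, hl⟩ := Y.exists_node_eq_endpoint c.2
      obtain ⟨c', hc'⟩ := hnode k l
      rw [hk, hl] at hc'
      have h1 : d c ≤ ‖α‖ * d c := hc'.trans (mul_le_mul_of_nonneg_left (hc c') (norm_nonneg _))
      nlinarith
    intro k l
    obtain ⟨c', hc'⟩ := hnode k l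
    have h0 : d c' ≤ 0 := (hc c').trans hd
    have h1 : |g (X.node k, Y.node l) - f (X.node k, Y.node l)| ≤ 0 :=
      hc'.trans (mul_nonpos_of_nonneg_of_nonpos (norm_nonneg _) h0)
    exact sub_eq_zero.1 (abs_nonpos_iff.1 h1)
  · exact (graph_eq_iff X Y α L f _).2 ((hfix _).2 hT.fixedPoint_isFixedPt)
  · intro g hg
    exact hT.fixedPoint_unique ((hfix g).1 ((graph_eq_iff X Y α L f g).1 hg.2))

/-- The fractal operator `f ↦ f^α`, where `f^α` is the unique `α`-fractal function of `f`. -/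
def fractalOperator (X Y : Grid) (α : C(Square, ℝ)) (L : C(Square, ℝ) →L[ℝ] C(Square, ℝ))
    (hα : ‖α‖ < 1) (hL : InterpolatesCorners L) (f : C(Square, ℝ)) : C(Square, ℝ) :=
  (existsUnique_isAlphaFractal X Y α L hα hL f).choose

/-- The polynomial functions `∑_{i ≤ m} ∑_{j ≤ n} a_ij x^i y^j` on the square. -/
def polyCoord (m n : ℕ) : Set C(Square, ℝ) :=
  {p | ∃ a : ℕ → ℕ → ℝ, ∀ q : Square, p q =
    ∑ i ∈ Finset.range (m + 1), ∑ j ∈ Finset.range (n + 1),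
      a i j * (q.1 : ℝ) ^ i * (q.2 : ℝ) ^ j}

/-- The polynomial functions of total degree at most `m + n` on the square. -/
def polyTotal (m n : ℕ) : Set C(Square, ℝ) :=
  {p | ∃ P : MvPolynomial (Fin 2) ℝ, P.totalDegree ≤ m + n ∧
    ∀ q : Square, p q = MvPolynomial.eval ![(q.1 : ℝ), (q.2 : ℝ)] P}

/-- Error of best uniform approximation of `f` from a set `V`. -/
def approxError (V : Set C(Square, ℝ)) (f : C(Square, ℝ)) : ℝ :=
  sInf ((fun g => ‖f - g‖) '' V)

/-- The weight `φ(x) = √(1 - x²)`. -/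
def phi (x : ℝ) : ℝ := √(1 - x ^ 2)

/-- The `r`-th symmetric difference of `f` at `(x, y)` with steps `h₁ φ(x)` and `h₂ φ(y)`, equal to
`0` when `(x ± r h₁ φ(x) / 2, y ± r h₂ φ(y) / 2)` are not all in the square. In the first case all
the points where `f` is evaluated lie in the square, so `Set.projIcc` leaves them unchanged. -/
def symmDifference (r : ℕ) (h₁ h₂ : ℝ) (f : C(Square, ℝ)) (p : Square) : ℝ :=
  open Classical in
  let x : ℝ := p.1
  let y : ℝ := p.2
  if x + r * h₁ * phi x / 2 ∈ Set.Icc (-1 : ℝ) 1 ∧ x - r * h₁ * phi x / 2 ∈ Set.Icc (-1 : ℝ) 1 ∧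
      y + r * h₂ * phi y / 2 ∈ Set.Icc (-1 : ℝ) 1 ∧ y - r * h₂ * phi y / 2 ∈ Set.Icc (-1 : ℝ) 1
  then ∑ k ∈ Finset.range (r + 1), (-1 : ℝ) ^ k * (r.choose k : ℝ) *
    f (Set.projIcc (-1 : ℝ) 1 (by norm_num) (x + h₁ * phi x * ((r : ℝ) / 2 - k)),
      Set.projIcc (-1 : ℝ) 1 (by norm_num) (y + h₂ * phi y * ((r : ℝ) / 2 - k)))
  else 0

/-- The bivariate Ditzian–Totik modulus of smoothness `ω_r^φ(f; δ₁, δ₂)`: the supremum of the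
absolute symmetric differences over `0 < h₁ ≤ δ₁`, `0 < h₂ ≤ δ₂` and all points of the square. -/
def modulus (r : ℕ) (f : C(Square, ℝ)) (δ₁ δ₂ : ℝ) : ℝ :=
  sSup {d | ∃ (h₁ h₂ : ℝ) (p : Square), 0 < h₁ ∧ h₁ ≤ δ₁ ∧ 0 < h₂ ∧ h₂ ≤ δ₂ ∧
    d = |symmDifference r h₁ h₂ f p|}

end

end BivariateFractal

open BivariateFractal

/-!
For `g` the fractal function of `p`, the self-referential equation `g - p = α (g - L p)` on every
cell gives `‖g - p‖ ≤ ‖α‖ ‖Id - L‖ / (1 - ‖α‖) ‖p‖`, so it suffices to approximate `f` by a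
polynomial `p` of coordinate degree `(m, n)` within a constant times the modulus of smoothness.

In one variable such approximations are given by a linear operator. Integrating a Jackson kernel
twice turns the truncated power `max (x - z) 0` into a polynomial of degree `m`, with an error of
order `φ(z) / m` that decays with the distance of `arccos x` and `arccos z` at scale `1 / m`. In the
piecewise linear interpolant of `f` at Chebyshev nodes, the coefficient of a truncated power is a
difference of slopes, which second differences of `f` bound up to the inverse of the node spacing,
again of order `φ(z) / m`. Replacing the truncated powers by the polynomials therefore costs
a summable multiple of the second differences of `f` with steps at most `φ / m`.

The bivariate approximation is the tensor product of two such operators. It only involves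
differences in one variable at a time, which the modulus bounds by letting the other step tend to
zero.
-/

namespace BivariateFractal

open Polynomial Real Set Filter Topology

/-! ### The Jackson kernel -/

/-- The polynomial whose value at `cos s` is `|∑_{k < N} exp (i k s)|²`, which is `N` times the
`N`-th Fejér kernel. -/
noncomputable def fejerPolynomial (N : ℕ) : ℝ[X] :=
  ∑ j ∈ Finset.range N, ∑ k ∈ Finset.range N, Chebyshev.T ℝ ((j : ℤ) - k)

lemma natDegree_fejerPolynomial_le (N : ℕ) : (fejerPolynomial N).natDegree ≤ N - 1 := by
  refine natDegree_sum_le_of_forall_le _ _ fun j hj =>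
    natDegree_sum_le_of_forall_le _ _ fun k hk => ?_
  rw [Chebyshev.natDegree_T]
  simp only [Finset.mem_range] at hj hk
  omega

lemma eval_cos_fejerPolynomial (N : ℕ) (s : ℝ) :
    (fejerPolynomial N).eval (cos s) =
      ∑ j ∈ Finset.range N, ∑ k ∈ Finset.range N, cos (((j : ℤ) - k : ℤ) * s) := by
  simp only [fejerPolynomial, eval_finsetSum, Chebyshev.T_real_cos]

lemma eval_cos_fejerPolynomial_eq_normSq (N : ℕ) (s : ℝ) :
    (fejerPolynomial N).eval (cos s) =
      Complex.normSq (∑ k ∈ Finset.range N, Complex.exp (s * Complex.I) ^ k) := by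
  have hpow (k : ℕ) : Complex.exp (s * Complex.I) ^ k = Complex.exp ((k * s : ℝ) * Complex.I) := by
    rw [← Complex.exp_nat_mul]
    push_cast
    ring_nf
  simp only [eval_cos_fejerPolynomial, hpow, Complex.normSq_apply, Complex.re_sum, Complex.im_sum,
    Complex.exp_ofReal_mul_I_re, Complex.exp_ofReal_mul_I_im, Finset.sum_mul_sum,
    ← Finset.sum_add_distrib, ← cos_sub]
  push_cast
  simp only [sub_mul]

lemma eval_cos_fejerPolynomial_nonneg (N : ℕ) (s : ℝ) : 0 ≤ (fejerPolynomial N).eval (cos s) := by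
  rw [eval_cos_fejerPolynomial_eq_normSq]
  exact Complex.normSq_nonneg _

lemma one_sub_cos_mul_eval_fejerPolynomial (N : ℕ) (s : ℝ) :
    (1 - cos s) * (fejerPolynomial N).eval (cos s) = 1 - cos (N * s) := by
  have hnormSq (x : ℝ) : Complex.normSq (Complex.exp (x * Complex.I) - 1) = 2 * (1 - cos x) := by
    simp only [Complex.normSq_apply, Complex.sub_re, Complex.sub_im, Complex.exp_ofReal_mul_I_re,
      Complex.exp_ofReal_mul_I_im, Complex.one_re, Complex.one_im]
    linear_combination sin_sq_add_cos_sq x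
  have hgeom := congrArg Complex.normSq (geom_sum_mul (Complex.exp (s * Complex.I)) N)
  rw [map_mul, ← eval_cos_fejerPolynomial_eq_normSq, hnormSq, ← Complex.exp_nat_mul,
    ← mul_assoc (N : ℂ), ← Complex.ofReal_natCast, ← Complex.ofReal_mul, hnormSq] at hgeom
  linarith

lemma eval_cos_fejerPolynomial_le_sq (N : ℕ) (s : ℝ) :
    (fejerPolynomial N).eval (cos s) ≤ (N : ℝ) ^ 2 := by
  rw [eval_cos_fejerPolynomial]
  calc ∑ j ∈ Finset.range N, ∑ k ∈ Finset.range N, cos (((j : ℤ) - k : ℤ) * s)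
      ≤ ∑ _j ∈ Finset.range N, ∑ _k ∈ Finset.range N, (1 : ℝ) := by
        gcongr
        exact cos_le_one _
    _ = (N : ℝ) ^ 2 := by simp [sq]

lemma sq_div_two_le_eval_cos_fejerPolynomial {N : ℕ} {s : ℝ} (hs : N * |s| ≤ 1) :
    (N : ℝ) ^ 2 / 2 ≤ (fejerPolynomial N).eval (cos s) := by
  have hcos (x : ℝ) (hx : |x| ≤ 1) : 1 / 2 ≤ cos x := by
    have := one_sub_sq_div_two_le_cos (x := x)
    have := (sq_le_one_iff_abs_le_one x).2 hx
    linarith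
  rw [eval_cos_fejerPolynomial]
  calc (N : ℝ) ^ 2 / 2 = ∑ _j ∈ Finset.range N, ∑ _k ∈ Finset.range N, (1 / 2 : ℝ) := by
        simp [sq]; ring
    _ ≤ _ := by
        gcongr with j hj k hk
        refine hcos _ ((abs_mul _ _).trans_le (le_trans ?_ hs))
        gcongr
        rw [← Int.cast_abs]
        simp only [Finset.mem_range] at hj hk
        exact_mod_cast (by rw [abs_le]; omega : |(j : ℤ) - k| ≤ N)

lemma eval_cos_fejerPolynomial_le_div (N : ℕ) {s : ℝ} (hs : s ∈ Icc 0 π) :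
    (fejerPolynomial N).eval (cos s) ≤ 22 * (N : ℝ) ^ 2 / (1 + N * s) ^ 2 := by
  set F := (fejerPolynomial N).eval (cos s)
  have hF : 0 ≤ F := eval_cos_fejerPolynomial_nonneg N s
  have hcos : 2 / π ^ 2 * s ^ 2 ≤ 1 - cos s := by
    have := cos_le_one_sub_mul_cos_sq (abs_le.2 ⟨by linarith [hs.1, pi_pos], hs.2⟩ : |s| ≤ π)
    linarith
  have hsF : s ^ 2 * F ≤ π ^ 2 := by
    have : 2 / π ^ 2 * s ^ 2 * F ≤ 2 := calc
      _ ≤ (1 - cos s) * F := by gcongr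
      _ = 1 - cos (N * s) := one_sub_cos_mul_eval_fejerPolynomial N s
      _ ≤ 2 := by linarith [neg_one_le_cos (N * s)]
    rw [div_mul_eq_mul_div, div_mul_eq_mul_div, div_le_iff₀ (by positivity)] at this
    linarith
  have hpi : π ^ 2 ≤ 10 := by nlinarith [pi_lt_d2, pi_pos]
  have hs0 := hs.1
  rw [le_div_iff₀ (by positivity)]
  calc F * (1 + N * s) ^ 2 ≤ F * (2 * (1 + N ^ 2 * s ^ 2)) := by
        gcongr
        nlinarith [sq_nonneg (1 - N * s)]
    _ = 2 * (F + N ^ 2 * (s ^ 2 * F)) := by ring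
    _ ≤ 2 * (N ^ 2 + N ^ 2 * 10) := by
        gcongr
        · exact eval_cos_fejerPolynomial_le_sq N s
        · exact hsF.trans hpi
    _ = 22 * (N : ℝ) ^ 2 := by ring

/-- `s ↦ Q (cos s)` is an even probability density on `[-π, π]` that is concentrated at scale
`1 / N` around `0`. The sixth power is the decay of the cube of the Fejér kernel. -/
structure IsJacksonKernel (K : ℝ) (N : ℕ) (Q : ℝ[X]) : Prop where
  nonneg (s : ℝ) : 0 ≤ Q.eval (cos s)
  integral_eq_one : ∫ s in (-π)..π, Q.eval (cos s) = 1
  le_div {s : ℝ} (hs : s ∈ Icc 0 π) : Q.eval (cos s) ≤ K * N / (1 + N * s) ^ 6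

lemma continuous_eval_cos (Q : ℝ[X]) : Continuous fun s => Q.eval (cos s) :=
  Q.continuous.comp continuous_cos

lemma pow_five_div_eight_le_integral_fejerPolynomial_pow_three {N : ℕ} (hN : 1 ≤ N) :
    (N : ℝ) ^ 5 / 8 ≤ ∫ s in (-π)..π, (fejerPolynomial N ^ 3).eval (cos s) := by
  have hN' : (1 : ℝ) ≤ N := by exact_mod_cast hN
  have hN1 : 1 / (N : ℝ) ≤ 1 := (div_le_one (by positivity)).2 hN'
  have hint (a b : ℝ) : IntervalIntegrable (fun s => (fejerPolynomial N ^ 3).eval (cos s))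
      MeasureTheory.volume a b := (continuous_eval_cos _).intervalIntegrable a b
  calc (N : ℝ) ^ 5 / 8 = ∫ _s in (0)..1 / (N : ℝ), ((N : ℝ) ^ 2 / 2) ^ 3 := by
        rw [intervalIntegral.integral_const]
        simp only [smul_eq_mul]
        field_simp
        norm_num
    _ ≤ ∫ s in (0)..1 / (N : ℝ), (fejerPolynomial N ^ 3).eval (cos s) := by
        refine intervalIntegral.integral_mono_on (by positivity) (by simp) (hint _ _) fun s hs => ?_
        rw [eval_pow]
        gcongr
        apply sq_div_two_le_eval_cos_fejerPolynomial
        rw [abs_of_nonneg hs.1, mul_comm]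
        exact (le_div_iff₀ (by positivity)).1 hs.2
    _ ≤ ∫ s in (-π)..π, (fejerPolynomial N ^ 3).eval (cos s) := by
        refine intervalIntegral.integral_mono_interval (by linarith [pi_pos]) (by positivity)
          (by linarith [pi_gt_three]) (.of_forall fun s => ?_) (hint _ _)
        exact (pow_nonneg (eval_cos_fejerPolynomial_nonneg N s) 3).trans_eq (eval_pow 3).symm

theorem exists_isJacksonKernel :
    ∃ K : ℝ, 0 < K ∧ ∀ N : ℕ, 1 ≤ N →
      ∃ Q : ℝ[X], Q.natDegree ≤ 3 * (N - 1) ∧ IsJacksonKernel K N Q := by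
  refine ⟨8 * 22 ^ 3, by norm_num, fun N hN => ?_⟩
  set F := fejerPolynomial N
  set I := ∫ s in (-π)..π, (F ^ 3).eval (cos s)
  have hI : (N : ℝ) ^ 5 / 8 ≤ I := pow_five_div_eight_le_integral_fejerPolynomial_pow_three hN
  have : (0 : ℝ) < N := by exact_mod_cast hN
  have hI0 : 0 < I := lt_of_lt_of_le (by positivity) hI
  have heval (s : ℝ) : (Polynomial.C I⁻¹ * F ^ 3).eval (cos s) = I⁻¹ * (F ^ 3).eval (cos s) := by
    rw [eval_mul, eval_C]
  refine ⟨Polynomial.C I⁻¹ * F ^ 3, ?_, fun s => ?_, ?_, fun {s} hs => ?_⟩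
  · exact (natDegree_C_mul_le _ _).trans
      (natDegree_pow_le_of_le 3 (natDegree_fejerPolynomial_le N))
  · rw [heval, eval_pow]
    exact mul_nonneg (inv_nonneg.2 hI0.le) (pow_nonneg (eval_cos_fejerPolynomial_nonneg N s) 3)
  · simp only [heval, intervalIntegral.integral_const_mul]
    exact inv_mul_cancel₀ hI0.ne'
  · have hs0 := hs.1
    calc (Polynomial.C I⁻¹ * F ^ 3).eval (cos s)
        ≤ ((N : ℝ) ^ 5 / 8)⁻¹ * (22 * (N : ℝ) ^ 2 / (1 + N * s) ^ 2) ^ 3 := by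
          rw [heval, eval_pow]
          gcongr
          · exact pow_nonneg (eval_cos_fejerPolynomial_nonneg N s) 3
          · exact eval_cos_fejerPolynomial_nonneg N s
          · exact eval_cos_fejerPolynomial_le_div N hs
      _ = 8 * 22 ^ 3 * N / (1 + N * s) ^ 6 := by field_simp

/-! ### Smoothing truncated powers -/

lemma integral_le_div_pow {g : ℝ → ℝ} {K N a b c : ℝ} {k : ℕ} (hk : 1 ≤ k) (hK : 0 ≤ K)
    (hN : 0 ≤ N) (hca : c ≤ a) (hab : a ≤ b) (hg : Continuous g)
    (hgle : ∀ u ∈ Icc a b, g u ≤ K * N / (1 + N * (u - c)) ^ (k + 1)) :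
    ∫ u in a..b, g u ≤ K / (1 + N * (a - c)) ^ k := by
  have hpos {u : ℝ} (hu : a ≤ u) : 0 < 1 + N * (u - c) := by
    have : 0 ≤ N * (u - c) := mul_nonneg hN (by linarith)
    linarith
  have hderiv {u : ℝ} (hu : a ≤ u) : HasDerivAt (fun u => -(K * ((1 + N * (u - c)) ^ k)⁻¹))
      (k * (K * N / (1 + N * (u - c)) ^ (k + 1))) u := by
    have hlin : HasDerivAt (fun u => 1 + N * (u - c)) N u := by
      simpa using (((hasDerivAt_id u).sub_const c).const_mul N).const_add 1
    refine (((hlin.fun_pow k).fun_inv (pow_ne_zero _ (hpos hu).ne')).const_mul K).neg.congr_deriv ?_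
    obtain ⟨j, rfl⟩ := Nat.exists_eq_add_of_le' hk
    have := (hpos hu).ne'
    simp only [Nat.add_sub_cancel]
    field_simp
    ring
  have hle := intervalIntegral.integral_le_sub_of_hasDeriv_right_of_le hab
    (fun u hu => (hderiv hu.1).continuousAt.continuousWithinAt)
    (fun u hu => (hderiv hu.1.le).hasDerivWithinAt) hg.integrableOn_Icc
    (fun u hu => (hgle u (Ioo_subset_Icc_self hu)).trans (le_mul_of_one_le_left
      (by have := hpos hu.1.le; positivity) (by exact_mod_cast hk)))
  refine hle.trans ?_
  have : 0 ≤ K * ((1 + N * (b - c)) ^ k)⁻¹ := by have := hpos hab; positivity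
  rw [div_eq_mul_inv]
  linarith

/-- The integral of `s ↦ Q (cos s)` over the arc of radius `t` around `θ`. For a Jackson kernel it
is a smoothed version of the indicator function of `θ < t`. -/
noncomputable def arcMass (Q : ℝ[X]) (t θ : ℝ) : ℝ := ∫ s in (θ - t)..(θ + t), Q.eval (cos s)

/-- A smoothed version of `θ ↦ max (cos θ - cos t) 0`, whose derivative `-sin θ` on `[0, t]` is cut
off by `arcMass Q t` instead of an indicator function. -/
noncomputable def smoothPosPart (Q : ℝ[X]) (t θ : ℝ) : ℝ := ∫ τ in θ..π, arcMass Q t τ * sin τ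

/-- The number `z` for which `smoothPosPart Q t` approximates `θ ↦ max (cos θ - z) 0`. It makes the
approximation exact in value at `θ = 0`. -/
noncomputable def smoothKnot (Q : ℝ[X]) (t : ℝ) : ℝ := 1 - smoothPosPart Q t 0

lemma integral_cos_mul_symm (t θ : ℝ) {r : ℝ} (hr : r ≠ 0) :
    ∫ s in (θ - t)..(θ + t), cos (r * s) = 2 * sin (r * t) / r * cos (r * θ) := by
  rw [intervalIntegral.integral_comp_mul_left cos hr, integral_cos, mul_add, mul_sub, sin_add,
    sin_sub, smul_eq_mul]
  field_simp
  ring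

lemma exists_natDegree_sub_C_mul_le {F : Type*} [Field F] {d : ℕ} {Q T : F[X]}
    (hQ : Q.natDegree ≤ d + 1) (hT : T.natDegree = d + 1) :
    ∃ c : F, (Q - Polynomial.C c * T).natDegree ≤ d := by
  have hlc : T.coeff (d + 1) ≠ 0 := by
    rw [← hT, coeff_natDegree, leadingCoeff_ne_zero]
    rintro rfl
    simp at hT
  refine ⟨Q.coeff (d + 1) / T.coeff (d + 1), natDegree_le_pred (n := d + 1) ?_ ?_⟩
  · exact (natDegree_sub_le _ _).trans (max_le hQ ((natDegree_C_mul_le _ _).trans hT.le))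
  · rw [coeff_sub, coeff_C_mul, div_mul_cancel₀ _ hlc, sub_self]

lemma exists_eval_cos_eq_arcMass (t : ℝ) {d : ℕ} {Q : ℝ[X]} (hQ : Q.natDegree ≤ d) :
    ∃ T : ℝ[X], T.natDegree ≤ d ∧ ∀ θ, T.eval (cos θ) = arcMass Q t θ := by
  induction d generalizing Q with
  | zero =>
    obtain ⟨c, rfl⟩ : ∃ c, Q = Polynomial.C c := ⟨_, eq_C_of_natDegree_le_zero hQ⟩
    refine ⟨Polynomial.C (2 * t * c), (natDegree_C _).le, fun θ => ?_⟩
    simp only [arcMass, eval_C, intervalIntegral.integral_const, smul_eq_mul]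
    ring
  | succ d ih =>
    set T := Chebyshev.T ℝ (d + 1 : ℤ)
    have hTdeg : T.natDegree = d + 1 := by
      rw [Chebyshev.natDegree_T]
      omega
    have hTcos (θ : ℝ) : T.eval (cos θ) = cos ((d + 1) * θ) := by
      have := Chebyshev.T_real_cos θ (d + 1 : ℤ)
      push_cast at this
      exact this
    obtain ⟨c, hc⟩ := exists_natDegree_sub_C_mul_le hQ hTdeg
    obtain ⟨S, hSdeg, hS⟩ := ih hc
    have hd : (d + 1 : ℝ) ≠ 0 := by positivity
    refine ⟨S + Polynomial.C (c * (2 * sin ((d + 1) * t) / (d + 1))) * T, ?_, fun θ => ?_⟩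
    · exact natDegree_add_le_of_degree_le (hSdeg.trans d.le_succ)
        ((natDegree_C_mul_le _ _).trans hTdeg.le)
    · have hsplit (s : ℝ) : Q.eval (cos s) =
          (Q - Polynomial.C c * T).eval (cos s) + c * cos ((d + 1) * s) := by
        rw [eval_sub, eval_mul, eval_C, hTcos]
        ring
      have hintegral : arcMass Q t θ =
          arcMass (Q - Polynomial.C c * T) t θ +
            c * ∫ s in (θ - t)..(θ + t), cos ((d + 1) * s) := by
        simp only [arcMass, hsplit]
        rw [← intervalIntegral.integral_const_mul]
        exact intervalIntegral.integral_add ((continuous_eval_cos _).intervalIntegrable _ _)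
          (Continuous.intervalIntegrable (by fun_prop) _ _)
      rw [hintegral, integral_cos_mul_symm t θ hd, eval_add, hS, eval_mul, eval_C, hTcos]
      ring

lemma exists_derivative_eq {F : Type*} [Field F] [CharZero F] (P : F[X]) (a : F) :
    ∃ R : F[X], R.natDegree ≤ P.natDegree + 1 ∧ derivative R = P ∧ R.eval a = 0 := by
  set S : F[X] := P.sum fun k c => monomial (k + 1) (c / (k + 1))
  have hS : S.natDegree ≤ P.natDegree + 1 :=
    natDegree_sum_le_of_forall_le _ _ fun k hk =>
      (natDegree_monomial_le _).trans (Nat.succ_le_succ (le_natDegree_of_mem_supp k hk))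
  have hderiv : derivative S = P := by
    conv_rhs => rw [← P.sum_monomial_eq]
    simp only [S, Polynomial.sum, derivative_sum, derivative_monomial, Nat.add_sub_cancel]
    refine Finset.sum_congr rfl fun k _ => ?_
    push_cast
    rw [div_mul_cancel₀ _ (Nat.cast_add_one_ne_zero k)]
  refine ⟨S - Polynomial.C (S.eval a), ?_, by simp [hderiv], by simp⟩
  exact (natDegree_sub_C).trans_le hS

lemma continuous_arcMass (Q : ℝ[X]) : Continuous fun p : ℝ × ℝ => arcMass Q p.1 p.2 := by
  have hint (a b : ℝ) := (continuous_eval_cos Q).intervalIntegrable (μ := MeasureTheory.volume) a b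
  have hprim : Continuous fun b => ∫ s in (0 : ℝ)..b, Q.eval (cos s) :=
    intervalIntegral.continuous_primitive hint 0
  refine ((hprim.comp (continuous_snd.add continuous_fst)).sub
    (hprim.comp (continuous_snd.sub continuous_fst))).congr fun p => ?_
  exact intervalIntegral.integral_interval_sub_left (hint _ _) (hint _ _)

lemma continuous_arcMass_mul_sin (Q : ℝ[X]) (t : ℝ) :
    Continuous fun τ => arcMass Q t τ * sin τ :=
  ((continuous_arcMass Q).comp (by fun_prop : Continuous fun τ => (t, τ))).mul continuous_sin

lemma exists_eval_cos_eq_smoothPosPart (t : ℝ) (Q : ℝ[X]) :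
    ∃ R : ℝ[X], R.natDegree ≤ Q.natDegree + 1 ∧ ∀ θ, R.eval (cos θ) = smoothPosPart Q t θ := by
  obtain ⟨T, hTdeg, hT⟩ := exists_eval_cos_eq_arcMass t le_rfl (Q := Q)
  obtain ⟨R, hRdeg, hR, hR0⟩ := exists_derivative_eq T (-1)
  have hderiv (τ : ℝ) : HasDerivAt (fun τ => -R.eval (cos τ)) (arcMass Q t τ * sin τ) τ := by
    refine ((R.hasDerivAt (cos τ)).comp τ (hasDerivAt_cos τ)).neg.congr_deriv ?_
    rw [hR, hT]
    ring
  refine ⟨R, hRdeg.trans (by omega), fun θ => ?_⟩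
  rw [smoothPosPart, intervalIntegral.integral_eq_sub_of_hasDerivAt (fun τ _ => hderiv τ)
    ((continuous_arcMass_mul_sin Q t).intervalIntegrable _ _), cos_pi, hR0]
  ring

namespace IsJacksonKernel

variable {K : ℝ} {N : ℕ} {Q : ℝ[X]}

lemma arcMass_pi (hQ : IsJacksonKernel K N Q) (θ : ℝ) : arcMass Q π θ = 1 := by
  have hper : Function.Periodic (fun s => Q.eval (cos s)) (2 * π) := fun s => by
    simp only [cos_add_two_pi]
  have h := hper.intervalIntegral_add_eq (θ - π) (-π)
  rw [show θ - π + 2 * π = θ + π by ring, show -π + 2 * π = π by ring, hQ.integral_eq_one] at h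
  exact h

lemma arcMass_pi_sub (hQ : IsJacksonKernel K N Q) (t θ : ℝ) :
    arcMass Q (π - t) (π - θ) = 1 - arcMass Q t θ := by
  have hint (a b : ℝ) := (continuous_eval_cos Q).intervalIntegrable (μ := MeasureTheory.volume) a b
  have hreflect : arcMass Q (π - t) (π - θ) = ∫ s in (θ + t)..(θ - t + 2 * π), Q.eval (cos s) := by
    have h := intervalIntegral.integral_comp_sub_left (a := π - θ - (π - t)) (b := π - θ + (π - t))
      (fun s => Q.eval (cos s)) (2 * π)
    simp only [cos_two_pi_sub] at h
    rw [arcMass, h]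
    congr 1 <;> ring
  have hcircle : ∫ s in (θ - t)..(θ - t + 2 * π), Q.eval (cos s) = 1 := by
    rw [← hQ.arcMass_pi (θ - t + π), arcMass]
    congr 1 <;> ring
  rw [hreflect, ← hcircle, arcMass,
    intervalIntegral.integral_interval_sub_left (hint _ _) (hint _ _)]

lemma arcMass_nonneg (hQ : IsJacksonKernel K N Q) {t : ℝ} (ht : 0 ≤ t) (θ : ℝ) :
    0 ≤ arcMass Q t θ :=
  intervalIntegral.integral_nonneg (by linarith) fun s _ => hQ.nonneg s

lemma arcMass_le (hQ : IsJacksonKernel K N Q) (hK : 0 ≤ K) {t θ : ℝ} (ht : 0 ≤ t) (htθ : t ≤ θ)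
    (hθ : θ ≤ π) : arcMass Q t θ ≤ 2 * K / (1 + N * (θ - t)) ^ 5 := by
  have hint (a b : ℝ) := (continuous_eval_cos Q).intervalIntegrable (μ := MeasureTheory.volume) a b
  have htail : ∫ s in (θ - t)..π, Q.eval (cos s) ≤ K / (1 + N * (θ - t)) ^ 5 := by
    have h := integral_le_div_pow (k := 5) (c := 0) (by norm_num) hK N.cast_nonneg
      (by linarith) (by linarith) (continuous_eval_cos Q) fun s (hs : s ∈ Icc (θ - t) π) => by
        rw [sub_zero]
        exact hQ.le_div ⟨by linarith [hs.1], hs.2⟩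
    rwa [sub_zero] at h
  have hmirror : ∫ s in π..(2 * π - (θ - t)), Q.eval (cos s) =
      ∫ s in (θ - t)..π, Q.eval (cos s) := by
    have h := intervalIntegral.integral_comp_sub_left (a := θ - t) (b := π)
      (fun s => Q.eval (cos s)) (2 * π)
    simp only [cos_two_pi_sub] at h
    rw [h]
    congr 1
    ring
  calc arcMass Q t θ ≤ ∫ s in (θ - t)..(2 * π - (θ - t)), Q.eval (cos s) :=
        intervalIntegral.integral_mono_interval le_rfl (by linarith) (by linarith)
          (.of_forall hQ.nonneg) (hint _ _)
    _ = (∫ s in (θ - t)..π, Q.eval (cos s)) + ∫ s in (θ - t)..π, Q.eval (cos s) := by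
        rw [← intervalIntegral.integral_add_adjacent_intervals (hint _ π) (hint _ _), hmirror]
    _ ≤ K / (1 + N * (θ - t)) ^ 5 + K / (1 + N * (θ - t)) ^ 5 := add_le_add htail htail
    _ = 2 * K / (1 + N * (θ - t)) ^ 5 := by ring

lemma smoothPosPart_nonneg (hQ : IsJacksonKernel K N Q) {t θ : ℝ} (ht : 0 ≤ t)
    (hθ : θ ∈ Icc 0 π) : 0 ≤ smoothPosPart Q t θ :=
  intervalIntegral.integral_nonneg hθ.2 fun _ hτ =>
    mul_nonneg (hQ.arcMass_nonneg ht _) (sin_nonneg_of_mem_Icc ⟨hθ.1.trans hτ.1, hτ.2⟩)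

lemma smoothPosPart_pi_sub (hQ : IsJacksonKernel K N Q) (t θ : ℝ) :
    smoothPosPart Q (π - t) (π - θ) = smoothPosPart Q t θ - (cos θ - smoothKnot Q t) := by
  have hint (a b : ℝ) :=
    (continuous_arcMass_mul_sin Q t).intervalIntegrable (μ := MeasureTheory.volume) a b
  have hreflect : smoothPosPart Q (π - t) (π - θ) =
      ∫ τ in (0)..θ, (sin τ - arcMass Q t τ * sin τ) := by
    have h := intervalIntegral.integral_comp_sub_left (a := 0) (b := θ)
      (fun τ => arcMass Q (π - t) τ * sin τ) π
    simp only [hQ.arcMass_pi_sub, sin_pi_sub, sub_mul, one_mul, sub_zero] at h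
    exact h.symm
  have hsplit : smoothPosPart Q t 0 =
      (∫ τ in (0)..θ, arcMass Q t τ * sin τ) + smoothPosPart Q t θ :=
    (intervalIntegral.integral_add_adjacent_intervals (hint _ _) (hint _ _)).symm
  rw [hreflect, intervalIntegral.integral_sub (continuous_sin.intervalIntegrable _ _) (hint _ _),
    integral_sin, cos_zero, smoothKnot, hsplit]
  ring

lemma smoothPosPart_le (hQ : IsJacksonKernel K N Q) (hK : 0 ≤ K) (hN : 1 ≤ N) {t θ : ℝ}
    (ht : 0 ≤ t) (htθ : t ≤ θ) (hθ : θ ≤ π) :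
    smoothPosPart Q t θ ≤ 2 * K * (sin t + 1 / N) / N / (1 + N * (θ - t)) ^ 3 := by
  have hN' : (0 : ℝ) < N := by exact_mod_cast hN
  have hsin_t : 0 ≤ sin t := sin_nonneg_of_mem_Icc ⟨ht, htθ.trans hθ⟩
  have hsin_le {τ : ℝ} (hτ : t ≤ τ) : sin τ ≤ (sin t + 1 / N) * (1 + N * (τ - t)) := by
    have hlip : sin τ - sin t ≤ τ - t := by
      have := (le_abs_self _).trans (abs_sin_sub_sin_le τ t)
      rwa [abs_of_nonneg (sub_nonneg.2 hτ)] at this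
    have hexpand : (sin t + 1 / N) * (1 + N * (τ - t)) =
        sin t + (τ - t) + (1 / N + sin t * (N * (τ - t))) := by
      field_simp
      ring
    have : 0 ≤ 1 / N + sin t * (N * (τ - t)) := by
      have := sub_nonneg.2 hτ
      positivity
    linarith
  refine integral_le_div_pow (by norm_num) (by positivity) hN'.le htθ hθ
    (continuous_arcMass_mul_sin Q t) fun τ hτ => ?_
  have htτ : 0 ≤ τ - t := sub_nonneg.2 (htθ.trans hτ.1)
  calc arcMass Q t τ * sin τ
      ≤ 2 * K / (1 + N * (τ - t)) ^ 5 * ((sin t + 1 / N) * (1 + N * (τ - t))) := by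
        gcongr
        · exact sin_nonneg_of_mem_Icc ⟨by linarith [hτ.1], hτ.2⟩
        · exact hQ.arcMass_le hK ht (htθ.trans hτ.1) hτ.2
        · exact hsin_le (htθ.trans hτ.1)
    _ = 2 * K * (sin t + 1 / N) / N * N / (1 + N * (τ - t)) ^ (3 + 1) := by
        field_simp

lemma exists_smoothKnot_eq (hQ : IsJacksonKernel K N Q) {z : ℝ} (hz : z ∈ Icc (-1) 1) :
    ∃ t ∈ Icc 0 π, smoothKnot Q t = z := by
  have hcont : Continuous (smoothKnot Q) := by
    refine continuous_const.sub
      (intervalIntegral.continuous_parametric_intervalIntegral_of_continuous' ?_ 0 π)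
    exact (continuous_arcMass Q).mul (continuous_sin.comp continuous_snd)
  have hzero : smoothKnot Q 0 = 1 := by simp [smoothKnot, smoothPosPart, arcMass]
  have hpi : smoothKnot Q π = -1 := by
    simp only [smoothKnot, smoothPosPart, hQ.arcMass_pi, one_mul, integral_sin, cos_zero, cos_pi]
    norm_num
  have := intermediate_value_Icc' pi_pos.le hcont.continuousOn
  rw [hzero, hpi] at this
  exact this hz

lemma abs_smoothPosPart_sub_max_le (hQ : IsJacksonKernel K N Q) (hK : 0 ≤ K) (hN : 1 ≤ N)
    {t θ : ℝ} (ht : t ∈ Icc 0 π) (hθ : θ ∈ Icc 0 π) :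
    |smoothPosPart Q t θ - max (cos θ - smoothKnot Q t) 0| ≤
      2 * K * (sin t + 1 / N) / N / (1 + N * |θ - t|) ^ 3 := by
  have hnonneg := hQ.smoothPosPart_nonneg ht.1 hθ
  have hnonneg' := hQ.smoothPosPart_nonneg (sub_nonneg.2 ht.2)
    (⟨sub_nonneg.2 hθ.2, sub_le_self _ hθ.1⟩ : π - θ ∈ Icc 0 π)
  rw [hQ.smoothPosPart_pi_sub] at hnonneg'
  rw [abs_of_nonneg (sub_nonneg.2 (max_le (by linarith) hnonneg))]
  rcases le_total t θ with htθ | htθ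
  · rw [abs_of_nonneg (sub_nonneg.2 htθ)]
    exact (sub_le_self _ (le_max_right _ _)).trans (hQ.smoothPosPart_le hK hN ht.1 htθ hθ.2)
  · have h := hQ.smoothPosPart_le hK hN (sub_nonneg.2 ht.2) (sub_le_sub_left htθ π)
      (sub_le_self _ hθ.1)
    rw [hQ.smoothPosPart_pi_sub, sin_pi_sub, sub_sub_sub_cancel_left] at h
    rw [abs_sub_comm, abs_of_nonneg (sub_nonneg.2 htθ)]
    exact (sub_le_sub_left (le_max_left _ _) _).trans h

lemma abs_smoothKnot_sub_cos_le (hQ : IsJacksonKernel K N Q) (hK : 0 ≤ K) (hN : 1 ≤ N) {t : ℝ}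
    (ht : t ∈ Icc 0 π) : |smoothKnot Q t - cos t| ≤ 2 * K * (sin t + 1 / N) / N := by
  have hpi_sub : π - t ∈ Icc 0 π := ⟨sub_nonneg.2 ht.2, sub_le_self _ ht.1⟩
  have hnonneg := hQ.smoothPosPart_nonneg ht.1 ht
  have hle := hQ.smoothPosPart_le hK hN ht.1 le_rfl ht.2
  have hnonneg' := hQ.smoothPosPart_nonneg hpi_sub.1 hpi_sub
  have hle' := hQ.smoothPosPart_le hK hN hpi_sub.1 le_rfl hpi_sub.2
  simp only [hQ.smoothPosPart_pi_sub, sin_pi_sub, sub_self, mul_zero, add_zero, one_pow, div_one]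
    at hle hle' hnonneg'
  rw [abs_le]
  constructor <;> linarith

end IsJacksonKernel

lemma sin_add_sin_mul_abs_sub_le {a b : ℝ} (ha : a ∈ Icc 0 π) (hb : b ∈ Icc 0 π) :
    (sin a + sin b) * |a - b| ≤ π * |cos a - cos b| := by
  wlog hab : b ≤ a generalizing a b
  · rw [add_comm, abs_sub_comm, abs_sub_comm (cos a)]
    exact this hb ha (le_of_not_ge hab)
  have hmean : 0 ≤ sin ((a + b) / 2) :=
    sin_nonneg_of_mem_Icc ⟨by linarith [ha.1, hb.1], by linarith [ha.2, hb.2]⟩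
  have hchord : (a - b) / π ≤ sin ((a - b) / 2) := by
    have := mul_le_sin (x := (a - b) / 2) (by linarith) (by linarith [ha.2, hb.1])
    rwa [show 2 / π * ((a - b) / 2) = (a - b) / π by ring] at this
  have hab' := sub_nonneg.2 hab
  calc (sin a + sin b) * |a - b|
      = 2 * sin ((a + b) / 2) * cos ((a - b) / 2) * (a - b) := by
        rw [sin_add_sin, abs_of_nonneg hab']
    _ ≤ 2 * sin ((a + b) / 2) * 1 * (a - b) := by
        gcongr
        exact cos_le_one _
    _ = π * (2 * sin ((a + b) / 2) * ((a - b) / π)) := by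
        field_simp
    _ ≤ π * (2 * sin ((a + b) / 2) * sin ((a - b) / 2)) := by gcongr
    _ ≤ π * |cos a - cos b| := by
        rw [cos_sub_cos, abs_mul, abs_mul, abs_of_nonneg hmean, abs_neg, abs_two]
        gcongr
        exact le_abs_self _

lemma cos_sub_cos_le_sin_mul {a b : ℝ} (ha : 0 ≤ a) (hab : a ≤ b) (hb : b ≤ π / 2) :
    cos a - cos b ≤ sin b * (b - a) := by
  have hmean : sin ((a + b) / 2) ≤ sin b := by
    apply sin_le_sin_of_le_of_le_pi_div_two <;> linarith [pi_pos]
  have hmean0 : 0 ≤ sin ((a + b) / 2) :=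
    sin_nonneg_of_nonneg_of_le_pi (by linarith) (by linarith [pi_pos])
  have hhalf : sin ((b - a) / 2) ≤ (b - a) / 2 := sin_le (by linarith)
  calc cos a - cos b = 2 * sin ((a + b) / 2) * sin ((b - a) / 2) := by
        rw [cos_sub_cos, show (a - b) / 2 = -((b - a) / 2) by ring, sin_neg]
        ring
    _ ≤ 2 * sin b * ((b - a) / 2) := by
        have : 0 ≤ sin b := hmean0.trans hmean
        exact (mul_le_mul_of_nonneg_left hhalf (by positivity)).trans (by gcongr)
    _ = sin b * (b - a) := by ring

lemma mul_abs_sub_le_of_abs_cos_sub_cos_le {K κ N t θ₀ : ℝ} (hK : 0 ≤ K) (hκ : 1 ≤ κ)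
    (hN : 0 < N) (ht : t ∈ Icc 0 π) (hθ₀ : θ₀ ∈ Icc 0 π) (hsin : 1 ≤ κ * N * sin θ₀)
    (hcos : |cos t - cos θ₀| ≤ K * (sin t + 1 / N) / N) : N * |t - θ₀| ≤ π * K * κ := by
  have hsin_t : 0 ≤ sin t := sin_nonneg_of_mem_Icc ht
  have hsin_θ₀ : 0 < sin θ₀ := pos_of_mul_pos_right (zero_lt_one.trans_le hsin) (by positivity)
  have hinv : 1 / N ≤ κ * sin θ₀ := by
    rw [div_le_iff₀ hN]
    linarith
  have hle : (sin t + sin θ₀) * |t - θ₀| ≤ (sin t + sin θ₀) * (π * K * κ / N) := calc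
    _ ≤ π * (K * (sin t + 1 / N) / N) :=
        (sin_add_sin_mul_abs_sub_le ht hθ₀).trans (by gcongr)
    _ ≤ π * (K * (κ * (sin t + sin θ₀)) / N) := by
        gcongr
        linarith [le_mul_of_one_le_left hsin_t hκ]
    _ = (sin t + sin θ₀) * (π * K * κ / N) := by ring
  have := le_of_mul_le_mul_left hle (by positivity)
  rw [le_div_iff₀ hN] at this
  linarith

lemma div_one_add_abs_pow_le {S S₀ N B θ t θ₀ : ℝ} (k : ℕ) (hN : 0 ≤ N) (hB : 0 ≤ B) (hS : S ≤ S₀)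
    (hS₀ : 0 ≤ S₀) (hdist : N * |t - θ₀| ≤ B) :
    S / (1 + N * |θ - t|) ^ k ≤ (1 + B) ^ k * S₀ / (1 + N * |θ - θ₀|) ^ k := by
  have htri : 1 + N * |θ - θ₀| ≤ (1 + B) * (1 + N * |θ - t|) := by
    have := mul_le_mul_of_nonneg_left (abs_sub_le θ t θ₀) hN
    have : 0 ≤ B * (N * |θ - t|) := by positivity
    linarith
  rw [div_le_div_iff₀ (by positivity) (by positivity)]
  calc S * (1 + N * |θ - θ₀|) ^ k ≤ S₀ * ((1 + B) * (1 + N * |θ - t|)) ^ k := by gcongr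
    _ = (1 + B) ^ k * S₀ * (1 + N * |θ - t|) ^ k := by rw [mul_pow]; ring

lemma sin_add_inv_le_mul_sin {κ B N t θ₀ : ℝ} (hB : 0 ≤ B) (hN : 0 < N)
    (hsin : 1 ≤ κ * N * sin θ₀) (hdist : N * |t - θ₀| ≤ B) :
    sin t + 1 / N ≤ (1 + (B + 1) * κ) * sin θ₀ := by
  have hlip : sin t - sin θ₀ ≤ B / N := by
    rw [le_div_iff₀' hN]
    exact le_trans (by gcongr; exact (le_abs_self _).trans (abs_sin_sub_sin_le t θ₀)) hdist
  have hscale : (B + 1) / N ≤ (B + 1) * κ * sin θ₀ := by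
    rw [div_le_iff₀' hN]
    have := le_mul_of_one_le_right (by positivity : 0 ≤ B + 1) hsin
    linarith
  rw [add_div] at hscale
  linarith

lemma phi_nonneg (x : ℝ) : 0 ≤ phi x := sqrt_nonneg _

lemma phi_neg (x : ℝ) : phi (-x) = phi x := by rw [phi, phi, neg_sq]

lemma phi_cos {θ : ℝ} (hθ : θ ∈ Icc 0 π) : phi (cos θ) = sin θ := by
  rw [phi, ← sin_sq, sqrt_sq (sin_nonneg_of_mem_Icc hθ)]

theorem exists_polynomial_approx_max {κ : ℝ} (hκ : 1 ≤ κ) :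
    ∃ c : ℝ, 0 < c ∧ ∀ N : ℕ, 1 ≤ N → ∀ z ∈ Icc (-1 : ℝ) 1, 1 ≤ κ * N * phi z →
      ∃ R : ℝ[X], R.natDegree ≤ 3 * (N - 1) + 1 ∧ ∀ x ∈ Icc (-1 : ℝ) 1,
        |R.eval x - max (x - z) 0| ≤ c * phi z / N / (1 + N * |arccos x - arccos z|) ^ 3 := by
  obtain ⟨K, hK, hkernel⟩ := exists_isJacksonKernel
  set B := π * (2 * K) * κ
  have hB : 0 < B := by have := zero_lt_one.trans_le hκ; positivity
  refine ⟨(1 + B) ^ 3 * (2 * K * (1 + (B + 1) * κ)), by positivity, fun N hN z hz hphi => ?_⟩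
  obtain ⟨Q, hQdeg, hQ⟩ := hkernel N hN
  obtain ⟨t, ht, hknot⟩ := hQ.exists_smoothKnot_eq hz
  obtain ⟨R, hRdeg, hR⟩ := exists_eval_cos_eq_smoothPosPart t Q
  have hN' : (0 : ℝ) < N := by exact_mod_cast hN
  have hz_mem : arccos z ∈ Icc 0 π := ⟨arccos_nonneg z, arccos_le_pi z⟩
  have hphi_eq : phi z = sin (arccos z) := (sin_arccos z).symm
  rw [hphi_eq] at hphi ⊢
  have hdist : N * |t - arccos z| ≤ B := by
    have := hQ.abs_smoothKnot_sub_cos_le hK.le hN ht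
    rw [hknot, abs_sub_comm, ← cos_arccos hz.1 hz.2] at this
    exact mul_abs_sub_le_of_abs_cos_sub_cos_le (by positivity) hκ hN' ht hz_mem hphi this
  have hsin_t := sin_add_inv_le_mul_sin hB.le hN' hphi hdist
  have hsin_z := sin_nonneg_of_mem_Icc hz_mem
  refine ⟨R, hRdeg.trans (by omega), fun x hx => ?_⟩
  have happrox := hQ.abs_smoothPosPart_sub_max_le hK.le hN ht
    (⟨arccos_nonneg x, arccos_le_pi x⟩ : arccos x ∈ Icc 0 π)
  rw [hknot, ← hR, cos_arccos hx.1 hx.2] at happrox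
  refine happrox.trans ((div_one_add_abs_pow_le 3 hN'.le hB.le
    (S₀ := 2 * K * ((1 + (B + 1) * κ) * sin (arccos z)) / N) (by gcongr) (by positivity)
    hdist).trans_eq ?_)
  ring

/-! ### Piecewise linear interpolation -/

lemma inv_sq_one_add_abs_le_sub (u : ℝ) :
    1 / (1 + |u|) ^ 2 ≤ 2 * ((u + 1) / (1 + |u + 1|) - u / (1 + |u|)) := by
  have hstep : |u + 1| ≤ |u| + 1 := (abs_add_le u 1).trans_eq (by rw [abs_one])
  have hlip : |(|u + 1| - |u|)| ≤ 1 := (abs_abs_sub_abs_le_abs_sub _ _).trans_eq (by simp)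
  have hmul : u * (|u + 1| - |u|) ≤ |u| * 1 :=
    (le_abs_self _).trans ((abs_mul _ _).trans_le (by gcongr))
  have habs := abs_nonneg u
  rw [div_sub_div _ _ (by positivity) (by positivity), mul_div_assoc',
    div_le_div_iff₀ (by positivity) (by positivity)]
  calc 1 * ((1 + |u + 1|) * (1 + |u|)) ≤ 1 * ((2 * (1 + |u|)) * (1 + |u|)) := by
        gcongr
        linarith
    _ = 2 * 1 * (1 + |u|) ^ 2 := by ring
    _ ≤ 2 * ((u + 1) * (1 + |u|) - (1 + |u + 1|) * u) * (1 + |u|) ^ 2 := by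
        gcongr
        linarith

lemma sum_inv_sq_one_add_abs_sub_le (y : ℝ) (n : ℕ) :
    ∑ k ∈ Finset.range n, 1 / (1 + |y - k|) ^ 2 ≤ 4 := by
  set g : ℝ → ℝ := fun u => u / (1 + |u|)
  have habs_g (u : ℝ) : |g u| ≤ 1 := by
    rw [abs_div, abs_of_pos (by positivity : 0 < 1 + |u|), div_le_one (by positivity)]
    linarith
  calc ∑ k ∈ Finset.range n, 1 / (1 + |y - k|) ^ 2
      ≤ ∑ k ∈ Finset.range n, 2 * (g ((k + 1 : ℕ) - y) - g (k - y)) := by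
        refine Finset.sum_le_sum fun k _ => ?_
        rw [abs_sub_comm, Nat.cast_succ, add_sub_right_comm]
        exact inv_sq_one_add_abs_le_sub _
    _ = 2 * (g (n - y) - g ((0 : ℕ) - y)) := by
        rw [← Finset.mul_sum, Finset.sum_range_sub fun k : ℕ => g (k - y)]
    _ ≤ 4 := by linarith [(abs_le.1 (habs_g (n - y))).2, (abs_le.1 (habs_g ((0 : ℕ) - y))).1]

/-- The symmetric second differences of `f` with all three points in `[a, b]` are at most `W` in
absolute value. -/
def SecondDifferencesLEOn (f : ℝ → ℝ) (a b W : ℝ) : Prop :=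
  ∀ ⦃x η : ℝ⦄, 0 ≤ η → a ≤ x - η → x + η ≤ b → |f (x + η) - 2 * f x + f (x - η)| ≤ W

namespace SecondDifferencesLEOn

variable {f : ℝ → ℝ} {a b W : ℝ}

lemma mono {a' b' : ℝ} (h : SecondDifferencesLEOn f a b W) (ha : a ≤ a') (hb : b' ≤ b) :
    SecondDifferencesLEOn f a' b' W :=
  fun _ _ hη hl hr => h hη (ha.trans hl) (hr.trans hb)

lemma sub_affine (h : SecondDifferencesLEOn f a b W) (u s z : ℝ) :
    SecondDifferencesLEOn (fun x => f x - (u + s * (x - z))) a b W := fun x η hη hl hr => by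
  convert h hη hl hr using 2
  ring

lemma abs_le_of_eq_zero (h : SecondDifferencesLEOn f a b W) (hf : ContinuousOn f (Icc a b))
    (ha : f a = 0) (hb : f b = 0) {x : ℝ} (hx : x ∈ Icc a b) : |f x| ≤ W := by
  obtain ⟨u, hu, hmax⟩ := isCompact_Icc.exists_isMaxOn ⟨x, hx⟩ hf.abs
  have hmax (v : ℝ) (hv : v ∈ Icc a b) : |f v| ≤ |f u| := hmax hv
  -- At a maximum point of `|f|`, a difference reaching to an end point sees the value `0` there.
  have hbound {v : ℝ} (hv : |f v| ≤ |f u|) (hdiff : |2 * f u - f v| ≤ W) : |f u| ≤ W := by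
    have := abs_sub_abs_le_abs_sub (2 * f u) (f v)
    rw [abs_mul, abs_two] at this
    linarith
  refine (hmax x hx).trans ?_
  rcases le_total (u - a) (b - u) with hle | hle
  · have hdiff := h (x := u) (sub_nonneg.2 hu.1) (by linarith) (by linarith)
    rw [sub_sub_cancel, ha, add_zero, abs_sub_comm] at hdiff
    exact hbound (hmax _ ⟨by linarith [hu.1], by linarith⟩) hdiff
  · have hdiff := h (x := u) (sub_nonneg.2 hu.2) (by linarith) (by linarith)
    rw [add_sub_cancel, hb, zero_sub, neg_add_eq_sub, abs_sub_comm] at hdiff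
    exact hbound (hmax _ ⟨by linarith, by linarith [hu.2]⟩) hdiff

lemma abs_sub_linearInterpolant_le (h : SecondDifferencesLEOn f a b W) (hab : a < b)
    (hf : ContinuousOn f (Icc a b)) {x : ℝ} (hx : x ∈ Icc a b) :
    |f x - (f a + (f b - f a) / (b - a) * (x - a))| ≤ W := by
  have hne : b - a ≠ 0 := (sub_pos.2 hab).ne'
  refine (h.sub_affine (f a) ((f b - f a) / (b - a)) a).abs_le_of_eq_zero
    (hf.sub (by fun_prop)) (by simp) ?_ hx
  field_simp
  ring

lemma abs_slope_sub_slope_mul_le {p q r : ℝ} (h : SecondDifferencesLEOn f p r W) (hpq : p < q)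
    (hqr : q < r) (hf : ContinuousOn f (Icc p r)) :
    |(f r - f q) / (r - q) - (f q - f p) / (q - p)| * min (q - p) (r - q) ≤ 2 * W := by
  have hp := sub_pos.2 hpq
  have hr := sub_pos.2 hqr
  have hleft {x : ℝ} := (h.mono le_rfl hqr.le).abs_sub_linearInterpolant_le hpq
    (hf.mono (Icc_subset_Icc_right hqr.le)) (x := x)
  have hright {x : ℝ} := (h.mono hpq.le le_rfl).abs_sub_linearInterpolant_le hqr
    (hf.mono (Icc_subset_Icc_left hpq.le)) (x := x)
  set s := (f q - f p) / (q - p) with hs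
  set t := (f r - f q) / (r - q) with ht
  rw [eq_div_iff hp.ne'] at hs
  rw [eq_div_iff hr.ne'] at ht
  rw [← abs_of_pos (lt_min hp hr), ← abs_mul]
  rcases le_total (q - p) (r - q) with hle | hle
  · have hdiff := h hp.le (sub_sub_cancel q p).ge (by linarith)
    have herror := hright (x := q + (q - p)) ⟨by linarith, by linarith⟩
    rw [sub_sub_cancel] at hdiff
    rw [min_eq_left hle]
    rw [abs_le] at *
    constructor <;> linarith
  · have hdiff := h hr.le (by linarith) (add_sub_cancel q r).le
    have herror := hleft (x := q - (r - q)) ⟨by linarith, by linarith⟩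
    rw [add_sub_cancel] at hdiff
    rw [min_eq_right hle]
    rw [abs_le] at *
    constructor <;> linarith

end SecondDifferencesLEOn

/-- The slope on the `k`-th cell of the piecewise linear interpolant with nodes `y` and
values `v`. -/
noncomputable def cellSlope (y v : ℕ → ℝ) (k : ℕ) : ℝ := (v (k + 1) - v k) / (y (k + 1) - y k)

lemma truncatedPower_sum_eq {y v : ℕ → ℝ} {n i : ℕ} (hy : StrictMonoOn y (Iic (n + 1)))
    (hi : i ≤ n) {x : ℝ} (hx : x ∈ Icc (y i) (y (i + 1))) :
    v 0 + cellSlope y v 0 * (x - y 0) + ∑ k ∈ Finset.range n,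
      (cellSlope y v (k + 1) - cellSlope y v k) * max (x - y (k + 1)) 0 =
    v i + cellSlope y v i * (x - y i) := by
  have hpartial : ∀ j ≤ i, v 0 + cellSlope y v 0 * (x - y 0) + ∑ k ∈ Finset.range j,
      (cellSlope y v (k + 1) - cellSlope y v k) * max (x - y (k + 1)) 0 =
        v j + cellSlope y v j * (x - y j) := by
    intro j hj
    induction j with
    | zero => simp
    | succ j ih =>
      have hslope : cellSlope y v j * (y (j + 1) - y j) = v (j + 1) - v j := by
        have := hy (mem_Iic.2 (by omega)) (mem_Iic.2 (by omega)) j.lt_succ_self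
        exact div_mul_cancel₀ _ (sub_pos.2 this).ne'
      have hle : y (j + 1) ≤ y i := hy.monotoneOn (mem_Iic.2 (by omega)) (mem_Iic.2 (by omega)) hj
      rw [Finset.sum_range_succ, ← add_assoc, ih (by omega), max_eq_left (by linarith [hx.1])]
      linarith
  rw [← hpartial i le_rfl]
  congr 1
  refine (Finset.sum_subset (Finset.range_mono hi) fun k hk hki => ?_).symm
  rw [Finset.mem_range] at hk hki
  have hle : y (i + 1) ≤ y (k + 1) :=
    hy.monotoneOn (mem_Iic.2 (by omega)) (mem_Iic.2 (by omega)) (by omega)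
  rw [max_eq_right (by linarith [hx.2]), mul_zero]

/-- The polynomial obtained from the piecewise linear interpolant with nodes `y` and `n + 1` cells,
written in terms of the truncated powers `max (x - y (k + 1)) 0`, by replacing these truncated
powers with the polynomials `R k`. It is linear in the sequence of interpolated values. -/
noncomputable def smoothedInterpolant (n : ℕ) (y : ℕ → ℝ) (R : ℕ → ℝ[X]) : (ℕ → ℝ) →ₗ[ℝ] ℝ[X] where
  toFun v := Polynomial.C (v 0) + Polynomial.C (cellSlope y v 0) * (X - Polynomial.C (y 0)) +
    ∑ k ∈ Finset.range n, Polynomial.C (cellSlope y v (k + 1) - cellSlope y v k) * R k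
  map_add' v w := by
    have hadd (k : ℕ) : cellSlope y (v + w) k = cellSlope y v k + cellSlope y w k := by
      simp only [cellSlope, Pi.add_apply]
      ring
    simp only [hadd, add_sub_add_comm, Pi.add_apply, map_add, add_mul, Finset.sum_add_distrib]
    ring
  map_smul' a v := by
    have hsmul (k : ℕ) : cellSlope y (a • v) k = a * cellSlope y v k := by
      simp only [cellSlope, Pi.smul_apply, smul_eq_mul]
      ring
    simp only [hsmul, ← mul_sub, Pi.smul_apply, smul_eq_mul, map_mul, mul_assoc, ← Finset.mul_sum,
      ← mul_add, smul_eq_C_mul, RingHom.id_apply]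

lemma smoothedInterpolant_congr {n : ℕ} {y v w : ℕ → ℝ} {R : ℕ → ℝ[X]}
    (h : ∀ k ≤ n + 1, v k = w k) : smoothedInterpolant n y R v = smoothedInterpolant n y R w := by
  have hslope (k : ℕ) (hk : k ≤ n) : cellSlope y v k = cellSlope y w k := by
    rw [cellSlope, cellSlope, h k (by omega), h (k + 1) (by omega)]
  simp only [smoothedInterpolant, LinearMap.coe_mk, AddHom.coe_mk, h 0 (by omega),
    hslope 0 (by omega)]
  congr 1
  refine Finset.sum_congr rfl fun k hk => ?_
  rw [Finset.mem_range] at hk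
  rw [hslope k hk.le, hslope (k + 1) hk]

lemma smoothedInterpolant_eq_sum (n : ℕ) (y v : ℕ → ℝ) (R : ℕ → ℝ[X]) :
    smoothedInterpolant n y R v =
      ∑ i : Fin (n + 2), v i • smoothedInterpolant n y R (Pi.single i 1) := by
  simp only [← map_smul, ← map_sum]
  refine smoothedInterpolant_congr fun k hk => ?_
  rw [← Finset.sum_range fun i => v i • Pi.single i (1 : ℝ)]
  simp [Finset.sum_apply, Pi.single_apply, Nat.lt_succ_of_le hk]

lemma natDegree_smoothedInterpolant_le {n m : ℕ} {y : ℕ → ℝ} {R : ℕ → ℝ[X]} (hm : 1 ≤ m)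
    (hR : ∀ k < n, (R k).natDegree ≤ m) (v : ℕ → ℝ) :
    (smoothedInterpolant n y R v).natDegree ≤ m := by
  refine natDegree_add_le_of_degree_le (natDegree_add_le_of_degree_le ?_ ?_)
    (natDegree_sum_le_of_forall_le _ _ fun k hk => ?_)
  · simp
  · exact (natDegree_C_mul_le _ _).trans ((natDegree_X_sub_C_le _).trans hm)
  · exact (natDegree_C_mul_le _ _).trans (hR k (Finset.mem_range.1 hk))

lemma abs_sub_eval_smoothedInterpolant_le {n : ℕ} {y : ℕ → ℝ} {R : ℕ → ℝ[X]} {f : ℝ → ℝ} {W : ℝ}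
    (hy : StrictMonoOn y (Iic (n + 1))) (hf : ContinuousOn f (Icc (y 0) (y (n + 1))))
    (hcell : ∀ k ≤ n, SecondDifferencesLEOn f (y k) (y (k + 1)) W)
    (hcells : ∀ k < n, SecondDifferencesLEOn f (y k) (y (k + 2)) W)
    {i : ℕ} (hi : i ≤ n) {x : ℝ} (hx : x ∈ Icc (y i) (y (i + 1))) :
    |f x - (smoothedInterpolant n y R (f ∘ y)).eval x| ≤ W + ∑ k ∈ Finset.range n,
      2 * W / min (y (k + 1) - y k) (y (k + 2) - y (k + 1)) *
        |(R k).eval x - max (x - y (k + 1)) 0| := by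
  set s := cellSlope y (f ∘ y)
  have hlt {j k : ℕ} (hjk : j < k) (hk : k ≤ n + 1) : y j < y k :=
    hy (mem_Iic.2 (by omega)) (mem_Iic.2 hk) hjk
  have hcont {j k : ℕ} (hk : k ≤ n + 1) (hj : j ≤ n + 1) : ContinuousOn f (Icc (y j) (y k)) :=
    hf.mono (Icc_subset_Icc (hy.monotoneOn (mem_Iic.2 (by omega)) (mem_Iic.2 hj) j.zero_le)
      (hy.monotoneOn (mem_Iic.2 hk) (mem_Iic.2 le_rfl) hk))
  have hspline := truncatedPower_sum_eq (v := f ∘ y) hy hi hx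
  have hsplit : f x - (smoothedInterpolant n y R (f ∘ y)).eval x =
      (f x - (f (y i) + s i * (x - y i))) + ∑ k ∈ Finset.range n,
        (s (k + 1) - s k) * (max (x - y (k + 1)) 0 - (R k).eval x) := by
    simp only [smoothedInterpolant, LinearMap.coe_mk, AddHom.coe_mk, eval_add, eval_mul, eval_C,
      eval_sub, eval_X, eval_finsetSum, mul_sub, Finset.sum_sub_distrib, Function.comp_apply,
      s] at hspline ⊢
    linarith
  rw [hsplit]
  refine (abs_add_le _ _).trans (add_le_add ?_ ((Finset.abs_sum_le_sum_abs _ _).trans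
    (Finset.sum_le_sum fun k hk => ?_)))
  · exact (hcell i hi).abs_sub_linearInterpolant_le (hlt i.lt_succ_self (by omega))
      (hcont (by omega) (by omega)) hx
  · rw [Finset.mem_range] at hk
    have hleft : y k < y (k + 1) := hlt k.lt_succ_self (by omega)
    have hright : y (k + 1) < y (k + 2) := hlt (k + 1).lt_succ_self (by omega)
    rw [abs_mul, abs_sub_comm (max _ _)]
    gcongr
    rw [le_div_iff₀ (lt_min (sub_pos.2 hleft) (sub_pos.2 hright))]
    exact (hcells k hk).abs_slope_sub_slope_mul_le hleft hright (hcont (by omega) (by omega))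

/-! ### The univariate Jackson estimate -/

/-- The symmetric second differences of `f` at the points `x` of `[-1, 1]` with steps at most
`δ φ(x)` are at most `W` in absolute value. -/
def WeightedSecondDifferencesLE (δ : ℝ) (f : ℝ → ℝ) (W : ℝ) : Prop :=
  ∀ ⦃x η : ℝ⦄, 0 ≤ η → η ≤ δ * phi x → -1 ≤ x - η → x + η ≤ 1 →
    |f (x + η) - 2 * f x + f (x - η)| ≤ W

lemma le_mul_phi_of_arccos_sub_arccos_le {p q x η δ : ℝ} (hη : 0 ≤ η) (hp : -1 ≤ p) (hq : q ≤ 1)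
    (hl : p ≤ x - η) (hr : x + η ≤ q) (hδ : arccos p - arccos q ≤ δ) : η ≤ δ * phi x := by
  wlog hx : 0 ≤ x generalizing p q x
  · rw [← phi_neg]
    refine this (p := -q) (q := -p) (by linarith) (by linarith) (by linarith) (by linarith) ?_
      (by linarith)
    rw [arccos_neg, arccos_neg]
    linarith
  have hangle : arccos (x + η) ≤ arccos x := antitone_arccos (by linarith)
  have hright : arccos q ≤ arccos (x + η) := antitone_arccos hr
  have hleft : arccos x ≤ arccos p := antitone_arccos (by linarith)
  calc η = cos (arccos (x + η)) - cos (arccos x) := by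
        rw [cos_arccos (by linarith) (by linarith), cos_arccos (by linarith) (by linarith)]
        ring
    _ ≤ sin (arccos x) * (arccos x - arccos (x + η)) :=
        cos_sub_cos_le_sin_mul (arccos_nonneg _) hangle (arccos_le_pi_div_two.2 hx)
    _ ≤ phi x * δ := by
        rw [sin_arccos]
        exact mul_le_mul_of_nonneg_left (by linarith) (phi_nonneg x)
    _ = δ * phi x := mul_comm _ _

namespace WeightedSecondDifferencesLE

variable {f : ℝ → ℝ} {δ W : ℝ}

lemma nonneg (h : WeightedSecondDifferencesLE δ f W) (hδ : 0 ≤ δ) : 0 ≤ W :=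
  (abs_nonneg _).trans <| h (x := 0) le_rfl (mul_nonneg hδ (phi_nonneg 0)) (by norm_num)
    (by norm_num)

lemma secondDifferencesLEOn (h : WeightedSecondDifferencesLE δ f W) {p q : ℝ} (hp : -1 ≤ p)
    (hq : q ≤ 1) (hδ : arccos p - arccos q ≤ δ) : SecondDifferencesLEOn f p q W :=
  fun _ _ hη hl hr => h hη (le_mul_phi_of_arccos_sub_arccos_le hη hp hq hl hr hδ)
    (hp.trans hl) (hr.trans hq)

end WeightedSecondDifferencesLE

/-- The extreme points of the Chebyshev polynomial of degree `M`, in increasing order from `-1`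
(for `k = 0`) to `1` (for `k = M`). -/
noncomputable def chebyshevNode (M k : ℕ) : ℝ := cos (π - k * π / M)

section ChebyshevNode

variable {M k : ℕ}

lemma chebyshevNode_mem (M k : ℕ) : chebyshevNode M k ∈ Icc (-1) 1 := cos_mem_Icc _

lemma chebyshevNode_zero (M : ℕ) : chebyshevNode M 0 = -1 := by simp [chebyshevNode]

lemma chebyshevNode_self (hM : 0 < M) : chebyshevNode M M = 1 := by
  have : (M : ℝ) ≠ 0 := by positivity
  simp [chebyshevNode, this]

lemma pi_sub_mem_Icc (hM : 0 < M) (hk : k ≤ M) : π - k * π / M ∈ Icc 0 π := by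
  have hle : k * π / M ≤ π := by
    rw [div_le_iff₀ (by positivity), mul_comm]
    gcongr
  exact ⟨sub_nonneg.2 hle, sub_le_self _ (by positivity)⟩

lemma arccos_chebyshevNode (hM : 0 < M) (hk : k ≤ M) :
    arccos (chebyshevNode M k) = π - k * π / M :=
  arccos_cos (pi_sub_mem_Icc hM hk).1 (pi_sub_mem_Icc hM hk).2

lemma phi_chebyshevNode (hM : 0 < M) (hk : k ≤ M) :
    phi (chebyshevNode M k) = sin (k * π / M) := by
  rw [chebyshevNode, phi_cos (pi_sub_mem_Icc hM hk), sin_pi_sub]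

lemma strictMonoOn_chebyshevNode (hM : 0 < M) : StrictMonoOn (chebyshevNode M) (Iic M) := by
  intro j hj k hk hjk
  refine strictAntiOn_cos (pi_sub_mem_Icc hM hk) (pi_sub_mem_Icc hM hj) ?_
  gcongr

lemma arccos_chebyshevNode_sub (hM : 0 < M) {d : ℕ} (hk : k + d ≤ M) :
    arccos (chebyshevNode M k) - arccos (chebyshevNode M (k + d)) = d * π / M := by
  rw [arccos_chebyshevNode hM hk, arccos_chebyshevNode hM (by omega)]
  push_cast
  ring

lemma phi_add_phi_div_le_chebyshevNode_sub (hM : 0 < M) (hk : k < M) :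
    (phi (chebyshevNode M k) + phi (chebyshevNode M (k + 1))) / M ≤
      chebyshevNode M (k + 1) - chebyshevNode M k := by
  have hle := strictMonoOn_chebyshevNode hM hk.le hk k.lt_succ_self
  have hchord := sin_add_sin_mul_abs_sub_le (pi_sub_mem_Icc hM hk.le) (pi_sub_mem_Icc hM hk)
  rw [← phi_cos (pi_sub_mem_Icc hM hk.le), ← phi_cos (pi_sub_mem_Icc hM hk)] at hchord
  change (phi (chebyshevNode M k) + phi (chebyshevNode M (k + 1))) * _ ≤
    π * |chebyshevNode M k - chebyshevNode M (k + 1)| at hchord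
  rw [abs_sub_comm (chebyshevNode M k), abs_of_pos (sub_pos.2 hle),
    show π - k * π / M - (π - (k + 1 : ℕ) * π / M) = π * (1 / M) by push_cast; ring,
    abs_of_nonneg (by positivity), mul_left_comm, mul_one_div] at hchord
  exact le_of_mul_le_mul_left hchord pi_pos

lemma phi_div_le_min_chebyshevNode_sub (hM : 0 < M) (hk : k + 2 ≤ M) :
    phi (chebyshevNode M (k + 1)) / M ≤ min (chebyshevNode M (k + 1) - chebyshevNode M k)
      (chebyshevNode M (k + 2) - chebyshevNode M (k + 1)) := by
  refine le_min ((?_ : _ ≤ _).trans (phi_add_phi_div_le_chebyshevNode_sub hM (by omega)))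
    ((?_ : _ ≤ _).trans (phi_add_phi_div_le_chebyshevNode_sub hM hk)) <;> gcongr
  · exact le_add_of_nonneg_left (phi_nonneg _)
  · exact le_add_of_nonneg_right (phi_nonneg _)

lemma two_div_le_phi_chebyshevNode (hk : 0 < k) (hkM : k < M) :
    2 / M ≤ phi (chebyshevNode M k) := by
  have hM : 0 < M := hk.trans hkM
  have hleft {j : ℕ} (hj : 1 ≤ j) (hhalf : j * π / M ≤ π / 2) : 2 / M ≤ sin (j * π / M) := calc
    (2 : ℝ) / M ≤ 2 / π * (j * π / M) := by
        rw [show 2 / π * (j * π / M) = 2 * j / M by field_simp]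
        gcongr
        exact le_mul_of_one_le_right zero_le_two (by exact_mod_cast hj)
    _ ≤ sin (j * π / M) := mul_le_sin (by positivity) hhalf
  rw [phi_chebyshevNode hM hkM.le]
  rcases le_total (k * π / M) (π / 2) with hhalf | hhalf
  · exact hleft hk hhalf
  · have hreflect : (M - k : ℕ) * π / M = π - k * π / M := by
      rw [Nat.cast_sub hkM.le]
      field_simp
    rw [← sin_pi_sub, ← hreflect]
    exact hleft (by omega) (by linarith)

lemma exists_mem_Icc_chebyshevNode {n : ℕ} {x : ℝ} (hx : x ∈ Icc (-1 : ℝ) 1) :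
    ∃ i ≤ n, x ∈ Icc (chebyshevNode (n + 1) i) (chebyshevNode (n + 1) (i + 1)) := by
  by_contra! hcell
  have hle : ∀ i ≤ n + 1, chebyshevNode (n + 1) i ≤ x := by
    intro i
    induction i with
    | zero => exact fun _ => (chebyshevNode_zero _).trans_le hx.1
    | succ i ih =>
      intro hi
      by_contra! hlt
      exact hcell i (by omega) ⟨ih (by omega), hlt.le⟩
  exact hcell n le_rfl ⟨hle n (by omega), hx.2.trans_eq (chebyshevNode_self n.succ_pos).symm⟩

end ChebyshevNode

lemma abs_sub_div_eight_le_mul_abs_arccos_sub {m k : ℕ} {N : ℝ} (hm : 0 < (m : ℝ))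
    (hN : m ≤ 3 * N) (hk : k ≤ 8 * m) (x : ℝ) :
    |(8 * m : ℕ) * (π - arccos x) / π - k| / 8 ≤
      N * |arccos x - arccos (chebyshevNode (8 * m) k)| := by
  have hscale : 1 / 8 ≤ N * (π / (8 * m)) := by
    rw [mul_div_assoc', div_le_div_iff₀ (by norm_num) (by positivity)]
    have := mul_le_mul_of_nonneg_left pi_gt_three.le (by linarith : 0 ≤ N)
    linarith
  calc |(8 * m : ℕ) * (π - arccos x) / π - k| / 8
      = 1 / 8 * |(8 * m : ℕ) * (π - arccos x) / π - k| := by ring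
    _ ≤ N * (π / (8 * m)) * |(8 * m : ℕ) * (π - arccos x) / π - k| := by gcongr
    _ = N * |π / (8 * m) * ((8 * m : ℕ) * (π - arccos x) / π - k)| := by
        rw [abs_mul, abs_of_pos (by positivity : 0 < π / (8 * m)), mul_assoc]
    _ = N * |arccos x - arccos (chebyshevNode (8 * m) k)| := by
        rw [arccos_chebyshevNode (by exact_mod_cast (by positivity : 0 < 8 * (m : ℝ))) hk,
          abs_sub_comm (arccos x)]
        congr 2
        push_cast
        field_simp
        ring

lemma exists_polynomial_approx_max_chebyshevNode : ∃ c : ℝ, 0 < c ∧ ∀ m k : ℕ, 0 < k → k < 8 * m →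
    ∃ R : ℝ[X], R.natDegree ≤ m ∧ ∀ x ∈ Icc (-1 : ℝ) 1,
      |R.eval x - max (x - chebyshevNode (8 * m) k) 0| ≤
        phi (chebyshevNode (8 * m) k) / (8 * m : ℕ) *
          (c * (1 / (1 + |(8 * m : ℕ) * (π - arccos x) / π - k|) ^ 2)) := by
  obtain ⟨c, hc, happrox⟩ := exists_polynomial_approx_max (κ := 12) (by norm_num)
  refine ⟨24 * 64 * c, by positivity, fun m k hk hkm => ?_⟩
  have hm : (0 : ℝ) < m := by exact_mod_cast (by omega : 0 < m)
  obtain ⟨N, hN, hNdeg, hNm⟩ : ∃ N : ℕ, 1 ≤ N ∧ 3 * (N - 1) + 1 ≤ m ∧ m ≤ 3 * N :=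
    ⟨(m - 1) / 3 + 1, by omega, by omega, by omega⟩
  have hNm' : (m : ℝ) ≤ 3 * N := by exact_mod_cast hNm
  have : (0 : ℝ) < N := by exact_mod_cast hN
  set z := chebyshevNode (8 * m) k
  have hphi : (2 : ℝ) / (8 * m : ℕ) ≤ phi z := two_div_le_phi_chebyshevNode hk hkm
  have hcoarse : 1 ≤ 12 * N * phi z := calc
    (1 : ℝ) = 12 * (m / 3) * (2 / (8 * m : ℕ)) := by
        push_cast
        field_simp
        norm_num
    _ ≤ 12 * N * phi z := by
        gcongr
        linarith
  obtain ⟨R, hRdeg, hR⟩ := happrox N hN z (chebyshevNode_mem _ _) hcoarse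
  refine ⟨R, hRdeg.trans hNdeg, fun x hx => (hR x hx).trans ?_⟩
  set u := (8 * m : ℕ) * (π - arccos x) / π
  have hdist : |u - k| / 8 ≤ N * |arccos x - arccos z| :=
    abs_sub_div_eight_le_mul_abs_arccos_sub hm hNm' hkm.le x
  have hphi0 := phi_nonneg z
  have hweight : ((1 + |u - k|) / 8) ^ 2 ≤ (1 + N * |arccos x - arccos z|) ^ 3 := calc
    _ ≤ (1 + N * |arccos x - arccos z|) ^ 2 := by
        gcongr
        linarith
    _ ≤ _ := pow_le_pow_right₀ (le_add_of_nonneg_right (by positivity)) (by norm_num)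
  calc c * phi z / N / (1 + N * |arccos x - arccos z|) ^ 3
      ≤ c * phi z / (m / 3) / ((1 + |u - k|) / 8) ^ 2 := by
        gcongr
        linarith
    _ = _ := by
        push_cast
        field_simp
        ring

/-- Nodes `z i` and polynomials `B i` of degree at most `m` for which the linear
operator `f ↦ ∑ i, f (z i) B i` satisfies a Jackson estimate with constant `c`, in terms of the
second differences of `f` with steps at most `φ / m`. -/
structure IsJacksonScheme (c : ℝ) (m : ℕ) {ι : Type} [Fintype ι] (z : ι → ℝ) (B : ι → ℝ[X]) :
    Prop where
  natDegree_le (i : ι) : (B i).natDegree ≤ m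
  abs_sub_le {f : ℝ → ℝ} {W : ℝ} (hf : ContinuousOn f (Icc (-1) 1))
    (hW : WeightedSecondDifferencesLE (1 / m) f W) {x : ℝ} (hx : x ∈ Icc (-1) 1) :
    |f x - ∑ i, f (z i) * (B i).eval x| ≤ c * W

lemma abs_sub_eval_smoothedInterpolant_chebyshevNode_le {n m : ℕ} {c : ℝ} {R : ℕ → ℝ[X]}
    (hc : 0 ≤ c) (hnm : 2 * π / (n + 1 : ℕ) ≤ 1 / m) {f : ℝ → ℝ} {W : ℝ}
    (hf : ContinuousOn f (Icc (-1) 1)) (hW : WeightedSecondDifferencesLE (1 / m) f W)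
    {x : ℝ} (hx : x ∈ Icc (-1) 1)
    (hR : ∀ k < n, |(R k).eval x - max (x - chebyshevNode (n + 1) (k + 1)) 0| ≤
      phi (chebyshevNode (n + 1) (k + 1)) / (n + 1 : ℕ) *
        (c * (1 / (1 + |(n + 1 : ℕ) * (π - arccos x) / π - (k + 1 : ℕ)|) ^ 2))) :
    |f x - (smoothedInterpolant n (chebyshevNode (n + 1)) R (f ∘ chebyshevNode (n + 1))).eval x| ≤
      (1 + 8 * c) * W := by
  have hM : 0 < n + 1 := n.succ_pos
  have hW0 : 0 ≤ W := hW.nonneg (by positivity)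
  set y := chebyshevNode (n + 1) with hy
  have hdiff {d k : ℕ} (hd : d ≤ 2) (hk : k + d ≤ n + 1) :
      SecondDifferencesLEOn f (y k) (y (k + d)) W := by
    refine hW.secondDifferencesLEOn (chebyshevNode_mem _ _).1 (chebyshevNode_mem _ _).2
      ((arccos_chebyshevNode_sub hM hk).trans_le (le_trans ?_ hnm))
    gcongr
    exact_mod_cast hd
  have hf' : ContinuousOn f (Icc (y 0) (y (n + 1))) := by
    rwa [hy, chebyshevNode_zero, chebyshevNode_self hM]
  obtain ⟨i, hi, hxi⟩ := exists_mem_Icc_chebyshevNode (n := n) hx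
  set v := (n + 1 : ℕ) * (π - arccos x) / π - 1 with hv
  calc _ ≤ W + ∑ k ∈ Finset.range n, 2 * W / min (y (k + 1) - y k) (y (k + 2) - y (k + 1)) *
          |(R k).eval x - max (x - y (k + 1)) 0| :=
        abs_sub_eval_smoothedInterpolant_le (strictMonoOn_chebyshevNode hM) hf'
          (fun k hk => hdiff (by omega) (by omega)) (fun k hk => hdiff le_rfl (by omega)) hi hxi
    _ ≤ W + ∑ k ∈ Finset.range n, 2 * W * c * (1 / (1 + |v - k|) ^ 2) := by
        refine add_le_add_right (Finset.sum_le_sum fun k hk => ?_) _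
        rw [Finset.mem_range] at hk
        have hphi : 0 < phi (y (k + 1)) / (n + 1 : ℕ) := div_pos
          ((by positivity : (0 : ℝ) < 2 / (n + 1 : ℕ)).trans_le
            (two_div_le_phi_chebyshevNode k.succ_pos (by omega))) (by positivity)
        refine (mul_le_mul (div_le_div_of_nonneg_left (by positivity) hphi
          (phi_div_le_min_chebyshevNode_sub hM (by omega))) (hR k hk) (abs_nonneg _)
          (by positivity)).trans_eq ?_
        rw [hv, sub_sub, add_comm 1 (k : ℝ), ← Nat.cast_succ, ← mul_assoc,
          div_mul_cancel₀ _ hphi.ne', ← mul_assoc]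
    _ ≤ W + 2 * W * c * 4 := by
        rw [← Finset.mul_sum]
        gcongr
        exact sum_inv_sq_one_add_abs_sub_le _ _
    _ = (1 + 8 * c) * W := by ring

theorem exists_isJacksonScheme : ∃ c : ℝ, 0 < c ∧ ∀ m : ℕ, 1 ≤ m →
    ∃ (ι : Type) (_ : Fintype ι) (z : ι → ℝ) (B : ι → ℝ[X]), IsJacksonScheme c m z B := by
  obtain ⟨c, hc, happrox⟩ := exists_polynomial_approx_max_chebyshevNode
  refine ⟨1 + 8 * c, by positivity, fun m hm => ?_⟩
  obtain ⟨n, hn⟩ : ∃ n, 8 * m = n + 1 := ⟨8 * m - 1, by omega⟩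
  have hnm : 2 * π / (n + 1 : ℕ) ≤ 1 / m := by
    have hm' : (0 : ℝ) < m := by exact_mod_cast hm
    rw [← hn, div_le_div_iff₀ (by positivity) hm']
    push_cast
    linarith [mul_le_mul_of_nonneg_right pi_le_four hm'.le]
  specialize happrox m
  rw [hn] at happrox
  choose! R hRdeg hR using fun k (hk : k < n) =>
    happrox (k + 1) k.succ_pos (Nat.succ_lt_succ hk)
  set y := chebyshevNode (n + 1)
  refine ⟨Fin (n + 2), inferInstance, fun i => y i,
    fun i => smoothedInterpolant n y R (Pi.single i 1),
    fun i => natDegree_smoothedInterpolant_le hm hRdeg _, fun {f W} hf hW x hx => ?_⟩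
  have hsum := congrArg (eval x) (smoothedInterpolant_eq_sum n y (f ∘ y) R)
  simp only [eval_finsetSum, eval_smul, smul_eq_mul, Function.comp_apply] at hsum
  rw [← hsum]
  exact abs_sub_eval_smoothedInterpolant_chebyshevNode_le hc.le hnm hf hW hx
    fun k hk => hR k hk x hx

/-! ### The bivariate Jackson estimate -/

lemma abs_symmDifference_le (r : ℕ) (h₁ h₂ : ℝ) (f : C(Square, ℝ)) (p : Square) :
    |symmDifference r h₁ h₂ f p| ≤ 2 ^ r * ‖f‖ := by
  rw [symmDifference]
  split_ifs
  · have hchoose : ∑ k ∈ Finset.range (r + 1), (r.choose k : ℝ) = 2 ^ r := by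
      exact_mod_cast Nat.sum_range_choose r
    refine (Finset.abs_sum_le_sum_abs _ _).trans ?_
    rw [← hchoose, Finset.sum_mul]
    refine Finset.sum_le_sum fun k _ => ?_
    rw [abs_mul, abs_mul, abs_neg_one_pow, one_mul, Nat.abs_cast]
    gcongr
    exact f.norm_coe_le_norm _
  · rw [abs_zero]
    positivity

lemma abs_symmDifference_le_modulus (r : ℕ) (f : C(Square, ℝ)) {h₁ h₂ δ₁ δ₂ : ℝ} (p : Square)
    (hh₁ : 0 < h₁) (hδ₁ : h₁ ≤ δ₁) (hh₂ : 0 < h₂) (hδ₂ : h₂ ≤ δ₂) :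
    |symmDifference r h₁ h₂ f p| ≤ modulus r f δ₁ δ₂ := by
  refine le_csSup ⟨2 ^ r * ‖f‖, ?_⟩ ⟨h₁, h₂, p, hh₁, hδ₁, hh₂, hδ₂, rfl⟩
  rintro _ ⟨h₁, h₂, p, -, -, -, -, rfl⟩
  exact abs_symmDifference_le r h₁ h₂ f p

/-- Extension of a function on the square to the plane, constant along the directions normal to
the sides. -/
noncomputable def squareExtend (f : C(Square, ℝ)) (x y : ℝ) : ℝ :=
  f (projIcc (-1) 1 (by norm_num) x, projIcc (-1) 1 (by norm_num) y)

lemma squareExtend_coe (f : C(Square, ℝ)) (p : Square) : squareExtend f p.1 p.2 = f p := by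
  simp [squareExtend]

@[fun_prop]
lemma continuous_squareExtend (f : C(Square, ℝ)) : Continuous ↿(squareExtend f) :=
  f.continuous.comp ((continuous_projIcc.comp continuous_fst).prodMk
    (continuous_projIcc.comp continuous_snd))

lemma symmDifference_two_eq (f : C(Square, ℝ)) {h₁ h₂ : ℝ} {p : Square} (hh₁ : 0 ≤ h₁)
    (hh₂ : 0 ≤ h₂) (hx : h₁ * phi p.1 ≤ 1 - |(p.1 : ℝ)|) (hy : h₂ * phi p.2 ≤ 1 - |(p.2 : ℝ)|) :
    symmDifference 2 h₁ h₂ f p =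
      squareExtend f (p.1 + h₁ * phi p.1) (p.2 + h₂ * phi p.2) - 2 * squareExtend f p.1 p.2 +
        squareExtend f (p.1 - h₁ * phi p.1) (p.2 - h₂ * phi p.2) := by
  have hstep_mem {h z : ℝ} (hh : 0 ≤ h) (hz : h * phi z ≤ 1 - |z|) :
      z + (2 : ℕ) * h * phi z / 2 ∈ Icc (-1) 1 ∧ z - (2 : ℕ) * h * phi z / 2 ∈ Icc (-1) 1 := by
    have hnonneg := mul_nonneg hh (phi_nonneg z)
    have hhalf : (2 : ℕ) * h * phi z / 2 = h * phi z := by push_cast; ring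
    rw [hhalf]
    refine ⟨⟨?_, ?_⟩, ?_, ?_⟩ <;> linarith [le_abs_self z, neg_abs_le z]
  rw [symmDifference, if_pos ⟨(hstep_mem hh₁ hx).1, (hstep_mem hh₁ hx).2, hstep_mem hh₂ hy⟩]
  norm_num [Finset.sum_range_succ, squareExtend]
  ring_nf

lemma eventually_max_mul_phi_le {x h : ℝ} (hh : 0 ≤ h) (hx : h * phi x ≤ 1 - |x|) :
    ∀ᶠ t in 𝓝[>] (0 : ℝ), max h t * phi x ≤ 1 - |x| := by
  rcases hh.eq_or_lt with rfl | hpos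
  · rw [zero_mul] at hx
    rcases hx.eq_or_lt with hend | hinner
    · have hphi : phi x = 0 := by
        rw [phi, ← sq_abs, ← sub_eq_zero.1 hend.symm, one_pow, sub_self, sqrt_zero]
      simp [hphi, hx]
    · have hlim : Tendsto (fun t => max 0 t * phi x) (𝓝[>] 0) (𝓝 (max 0 0 * phi x)) :=
        (by fun_prop : Continuous fun t : ℝ => max 0 t * phi x).continuousAt.tendsto.mono_left
          nhdsWithin_le_nhds
      rw [max_self, zero_mul] at hlim
      filter_upwards [hlim.eventually_lt_const hinner] with t ht using ht.le
  · filter_upwards [Ioo_mem_nhdsGT hpos] with t ht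
    rwa [max_eq_left ht.2.le]

/- The definition of the modulus excludes vanishing steps, which give the differences in a single
variable; they are limits of positive ones. -/
lemma abs_secondDifference_le_modulus (f : C(Square, ℝ)) {h₁ h₂ δ₁ δ₂ : ℝ} {p : Square}
    (hδ₁ : 0 < δ₁) (hδ₂ : 0 < δ₂) (hh₁ : h₁ ∈ Icc 0 δ₁) (hh₂ : h₂ ∈ Icc 0 δ₂)
    (hx : h₁ * phi p.1 ≤ 1 - |(p.1 : ℝ)|) (hy : h₂ * phi p.2 ≤ 1 - |(p.2 : ℝ)|) :
    |squareExtend f (p.1 + h₁ * phi p.1) (p.2 + h₂ * phi p.2) - 2 * squareExtend f p.1 p.2 +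
      squareExtend f (p.1 - h₁ * phi p.1) (p.2 - h₂ * phi p.2)| ≤ modulus 2 f δ₁ δ₂ := by
  let G : ℝ → ℝ := fun t =>
    |squareExtend f (p.1 + max h₁ t * phi p.1) (p.2 + max h₂ t * phi p.2) -
      2 * squareExtend f p.1 p.2 +
      squareExtend f (p.1 - max h₁ t * phi p.1) (p.2 - max h₂ t * phi p.2)|
  have hG : Tendsto G (𝓝[>] 0) (𝓝 (G 0)) :=
    (by fun_prop : Continuous G).continuousAt.tendsto.mono_left nhdsWithin_le_nhds
  have hle : ∀ᶠ t in 𝓝[>] 0, G t ≤ modulus 2 f δ₁ δ₂ := by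
    filter_upwards [eventually_max_mul_phi_le hh₁.1 hx, eventually_max_mul_phi_le hh₂.1 hy,
      Ioo_mem_nhdsGT hδ₁, Ioo_mem_nhdsGT hδ₂] with t htx hty ht₁ ht₂
    have hpos (h : ℝ) : 0 < max h t := lt_max_of_lt_right ht₁.1
    have := abs_symmDifference_le_modulus 2 f p (hpos h₁) (max_le hh₁.2 ht₁.2.le) (hpos h₂)
      (max_le hh₂.2 ht₂.2.le)
    rwa [symmDifference_two_eq f (hpos h₁).le (hpos h₂).le htx hty] at this
  simpa only [G, max_eq_left hh₁.1, max_eq_left hh₂.1] using le_of_tendsto hG hle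

lemma exists_step_eq {x η δ : ℝ} (hη : 0 ≤ η) (hδ : η ≤ δ * phi x) (hδ0 : 0 ≤ δ) :
    ∃ h ∈ Icc 0 δ, h * phi x = η := by
  have hphi := phi_nonneg x
  refine ⟨η / phi x, ⟨by positivity, div_le_of_le_mul₀ hphi hδ0 hδ⟩, div_mul_cancel_of_imp ?_⟩
  intro hzero
  rw [hzero, mul_zero] at hδ
  exact hδ.antisymm hη

lemma weightedSecondDifferencesLE_squareExtend_left (f : C(Square, ℝ)) {δ₁ δ₂ : ℝ} (hδ₁ : 0 < δ₁)
    (hδ₂ : 0 < δ₂) {y : ℝ} (hy : y ∈ Icc (-1) 1) :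
    WeightedSecondDifferencesLE δ₁ (fun x => squareExtend f x y) (modulus 2 f δ₁ δ₂) := by
  intro x η hη hηδ hl hr
  obtain ⟨h, hh, rfl⟩ := exists_step_eq hη hηδ hδ₁.le
  have hx : |x| ≤ 1 - h * phi x := abs_le.2 ⟨by linarith, by linarith⟩
  have hx_mem : x ∈ Icc (-1) 1 := ⟨by linarith, by linarith⟩
  simpa using abs_secondDifference_le_modulus f (p := (⟨x, hx_mem⟩, ⟨y, hy⟩)) hδ₁ hδ₂ hh
    (h₂ := 0) (left_mem_Icc.2 hδ₂.le) (by simpa using by linarith) (by simpa using abs_le.2 hy)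

lemma weightedSecondDifferencesLE_squareExtend_right (f : C(Square, ℝ)) {δ₁ δ₂ : ℝ} (hδ₁ : 0 < δ₁)
    (hδ₂ : 0 < δ₂) {x : ℝ} (hx : x ∈ Icc (-1) 1) :
    WeightedSecondDifferencesLE δ₂ (squareExtend f x) (modulus 2 f δ₁ δ₂) := by
  intro y η hη hηδ hl hr
  obtain ⟨h, hh, rfl⟩ := exists_step_eq hη hηδ hδ₂.le
  have hy : |y| ≤ 1 - h * phi y := abs_le.2 ⟨by linarith, by linarith⟩
  have hy_mem : y ∈ Icc (-1) 1 := ⟨by linarith, by linarith⟩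
  simpa using abs_secondDifference_le_modulus f (p := (⟨x, hx⟩, ⟨y, hy_mem⟩)) hδ₁ hδ₂
    (h₁ := 0) (left_mem_Icc.2 hδ₁.le) hh (by simpa using abs_le.2 hx) (by simpa using by linarith)

lemma weightedSecondDifferencesLE_of_abs_le {δ K : ℝ} {g : ℝ → ℝ}
    (hg : ∀ x ∈ Icc (-1) 1, |g x| ≤ K) : WeightedSecondDifferencesLE δ g (4 * K) := by
  intro x η hη _ hl hr
  have hright := abs_le.1 (hg (x + η) ⟨by linarith, hr⟩)
  have hmid := abs_le.1 (hg x ⟨by linarith, by linarith⟩)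
  have hleft := abs_le.1 (hg (x - η) ⟨hl, by linarith⟩)
  exact abs_le.2 ⟨by linarith, by linarith⟩

/- If `g x` is the error at `y` of the second scheme applied to `F x`, the error of the tensor
product is that of the first scheme applied to `F · y`, plus the first scheme applied to `g`. -/
lemma IsJacksonScheme.abs_sub_sum_sum_le {b d : ℝ} {m n : ℕ} {ι κ : Type} [Fintype ι] [Fintype κ]
    {z : ι → ℝ} {w : κ → ℝ} {B : ι → ℝ[X]} {D : κ → ℝ[X]}
    (hB : IsJacksonScheme b m z B) (hD : IsJacksonScheme d n w D) {F : ℝ → ℝ → ℝ} {W : ℝ}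
    (hF : Continuous ↿F)
    (hF₁ : ∀ y ∈ Icc (-1) 1, WeightedSecondDifferencesLE (1 / m) (fun x => F x y) W)
    (hF₂ : ∀ x ∈ Icc (-1) 1, WeightedSecondDifferencesLE (1 / n) (F x) W) {x y : ℝ}
    (hx : x ∈ Icc (-1) 1) (hy : y ∈ Icc (-1) 1) :
    |F x y - ∑ i, ∑ j, F (z i) (w j) * ((B i).eval x * (D j).eval y)| ≤
      (b + d + 4 * b * d) * W := by
  let g : ℝ → ℝ := fun s => F s y - ∑ j, F s (w j) * (D j).eval y
  have hg (s : ℝ) (hs : s ∈ Icc (-1) 1) : |g s| ≤ d * W :=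
    hD.abs_sub_le (by fun_prop) (hF₂ s hs) hy
  have herror_F := hB.abs_sub_le (by fun_prop) (hF₁ y hy) hx
  have herror_g := hB.abs_sub_le (by fun_prop) (weightedSecondDifferencesLE_of_abs_le hg) hx
  have hsplit : F x y - ∑ i, ∑ j, F (z i) (w j) * ((B i).eval x * (D j).eval y) =
      (F x y - ∑ i, F (z i) y * (B i).eval x) + g x - (g x - ∑ i, g (z i) * (B i).eval x) := by
    simp only [g, sub_mul, Finset.sum_mul, Finset.sum_sub_distrib, mul_assoc,
      mul_comm (eval y _) (eval x _)]
    ring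
  rw [hsplit]
  have hgx := abs_le.1 (hg x hx)
  rw [abs_le] at herror_F herror_g ⊢
  constructor <;> linarith

lemma sum_sum_eval_mul_eval_mem_polyCoord {m n : ℕ} {ι κ : Type*} [Fintype ι] [Fintype κ]
    {B : ι → ℝ[X]} {D : κ → ℝ[X]} (hB : ∀ i, (B i).natDegree ≤ m) (hD : ∀ j, (D j).natDegree ≤ n)
    (a : ι → κ → ℝ) {p : C(Square, ℝ)}
    (hp : ∀ q : Square, p q = ∑ i, ∑ j, a i j * ((B i).eval (q.1 : ℝ) * (D j).eval (q.2 : ℝ))) :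
    p ∈ polyCoord m n := by
  refine ⟨fun k l => ∑ i, ∑ j, a i j * ((B i).coeff k * (D j).coeff l), fun q => ?_⟩
  have hterm (i : ι) (j : κ) : a i j * ((B i).eval (q.1 : ℝ) * (D j).eval (q.2 : ℝ)) =
      ∑ k ∈ Finset.range (m + 1), ∑ l ∈ Finset.range (n + 1),
        a i j * ((B i).coeff k * (D j).coeff l) * (q.1 : ℝ) ^ k * (q.2 : ℝ) ^ l := by
    rw [eval_eq_sum_range' (Nat.lt_succ_of_le (hB i)),
      eval_eq_sum_range' (Nat.lt_succ_of_le (hD j)), Finset.sum_mul_sum]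
    simp only [Finset.mul_sum]
    exact Finset.sum_congr rfl fun k _ => Finset.sum_congr rfl fun l _ => by ring
  simp only [hp, hterm, Finset.sum_mul]
  rw [Finset.sum_comm_cycle]
  exact Finset.sum_congr rfl fun k _ => Finset.sum_comm_cycle

theorem exists_mem_polyCoord_norm_sub_le : ∃ c : ℝ, 0 < c ∧ ∀ m n : ℕ, 1 ≤ m → 1 ≤ n →
    ∀ f : C(Square, ℝ), ∃ p ∈ polyCoord m n, ‖f - p‖ ≤ c * modulus 2 f (1 / m) (1 / n) := by
  obtain ⟨c, hc, hscheme⟩ := exists_isJacksonScheme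
  refine ⟨c + c + 4 * c * c, by positivity, fun m n hm hn f => ?_⟩
  have hm' : 0 < 1 / (m : ℝ) := by positivity
  have hn' : 0 < 1 / (n : ℝ) := by positivity
  obtain ⟨ι, _, z, B, hB⟩ := hscheme m hm
  obtain ⟨κ, _, w, D, hD⟩ := hscheme n hn
  have hleft := fun y => weightedSecondDifferencesLE_squareExtend_left f hm' hn' (y := y)
  have hright := fun x => weightedSecondDifferencesLE_squareExtend_right f hm' hn' (x := x)
  have hmodulus : 0 ≤ modulus 2 f (1 / m) (1 / n) := (hleft 0 (by norm_num)).nonneg hm'.le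
  let p : C(Square, ℝ) := ⟨fun q => ∑ i, ∑ j, squareExtend f (z i) (w j) *
    ((B i).eval (q.1 : ℝ) * (D j).eval (q.2 : ℝ)), by fun_prop⟩
  refine ⟨p, sum_sum_eval_mul_eval_mem_polyCoord hB.natDegree_le hD.natDegree_le _ fun q => rfl,
    (ContinuousMap.norm_le _ (by positivity)).2 fun q => ?_⟩
  rw [ContinuousMap.sub_apply, ← squareExtend_coe f q]
  exact hB.abs_sub_sum_sum_le hD (continuous_squareExtend f) hleft hright q.1.2 q.2.2

lemma polyCoord_subset_polyTotal (m n : ℕ) : polyCoord m n ⊆ polyTotal m n := by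
  rintro p ⟨a, ha⟩
  refine ⟨∑ i ∈ Finset.range (m + 1), ∑ j ∈ Finset.range (n + 1),
    MvPolynomial.C (a i j) * MvPolynomial.X 0 ^ i * MvPolynomial.X 1 ^ j, ?_, fun q => ?_⟩
  · refine MvPolynomial.totalDegree_finsetSum_le fun i hi =>
      MvPolynomial.totalDegree_finsetSum_le fun j hj => ?_
    rw [Finset.mem_range] at hi hj
    calc _ ≤ (MvPolynomial.C (a i j) : MvPolynomial (Fin 2) ℝ).totalDegree +
          (MvPolynomial.X 0 ^ i : MvPolynomial (Fin 2) ℝ).totalDegree +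
          (MvPolynomial.X 1 ^ j : MvPolynomial (Fin 2) ℝ).totalDegree :=
          (MvPolynomial.totalDegree_mul _ _).trans
            (add_le_add_left (MvPolynomial.totalDegree_mul _ _) _)
      _ ≤ m + n := by
          rw [MvPolynomial.totalDegree_C, MvPolynomial.totalDegree_X_pow,
            MvPolynomial.totalDegree_X_pow]
          omega
  · simp [ha]

/-! ### Approximation by fractal functions -/

lemma approxError_le {V : Set C(Square, ℝ)} {f g : C(Square, ℝ)} (hg : g ∈ V) :
    approxError V f ≤ ‖f - g‖ := by
  refine csInf_le ⟨0, ?_⟩ ⟨g, hg, rfl⟩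
  rintro _ ⟨g, -, rfl⟩
  exact norm_nonneg _

lemma isAlphaFractal_fractalOperator (X Y : Grid) (α : C(Square, ℝ))
    (L : C(Square, ℝ) →L[ℝ] C(Square, ℝ)) (hα : ‖α‖ < 1) (hL : InterpolatesCorners L)
    (f : C(Square, ℝ)) : IsAlphaFractal X Y α L f (fractalOperator X Y α L hα hL f) :=
  (existsUnique_isAlphaFractal X Y α L hα hL f).choose_spec.1

namespace IsAlphaFractal

variable {X Y : Grid} {α f g : C(Square, ℝ)} {L : C(Square, ℝ) →L[ℝ] C(Square, ℝ)}

lemma norm_sub_le (h : IsAlphaFractal X Y α L f g) : ‖g - f‖ ≤ ‖α‖ * ‖g - L f‖ := by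
  rw [ContinuousMap.norm_le _ (by positivity)]
  rintro ⟨s, t⟩
  obtain ⟨i, x, rfl⟩ := X.cellMap_surjective s
  obtain ⟨j, y, rfl⟩ := Y.cellMap_surjective t
  have hself : (g - f) (cell X Y i j (x, y)) = α (cell X Y i j (x, y)) * (g - L f) (x, y) := by
    rw [ContinuousMap.sub_apply, (graph_eq_iff X Y α L f g).1 h.2 i j (x, y), ifsHeight,
      ContinuousMap.sub_apply]
    ring
  change ‖(g - f) (cell X Y i j (x, y))‖ ≤ _
  rw [hself, norm_mul]
  exact mul_le_mul (α.norm_coe_le_norm _) ((g - L f).norm_coe_le_norm _) (norm_nonneg _)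
    (norm_nonneg _)

lemma norm_sub_le_mul_norm (h : IsAlphaFractal X Y α L f g) (hα : ‖α‖ < 1) :
    ‖g - f‖ ≤ ‖α‖ * ‖ContinuousLinearMap.id ℝ C(Square, ℝ) - L‖ / (1 - ‖α‖) * ‖f‖ := by
  have hL : ‖f - L f‖ ≤ ‖ContinuousLinearMap.id ℝ C(Square, ℝ) - L‖ * ‖f‖ :=
    (ContinuousLinearMap.id ℝ C(Square, ℝ) - L).le_opNorm f
  have hself := h.norm_sub_le.trans
    (mul_le_mul_of_nonneg_left (norm_sub_le_norm_sub_add_norm_sub g f (L f)) (norm_nonneg α))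
  have := mul_le_mul_of_nonneg_left hL (norm_nonneg α)
  rw [div_mul_eq_mul_div, le_div_iff₀ (sub_pos.2 hα)]
  linarith

lemma norm_sub_le_of_approx {p : C(Square, ℝ)} {E : ℝ} (h : IsAlphaFractal X Y α L p g)
    (hα : ‖α‖ < 1) (hE : ‖f - p‖ ≤ E) :
    ‖f - g‖ ≤ (1 + ‖α‖ * (‖ContinuousLinearMap.id ℝ C(Square, ℝ) - L‖ - 1)) / (1 - ‖α‖) * E +
      ‖α‖ * ‖ContinuousLinearMap.id ℝ C(Square, ℝ) - L‖ / (1 - ‖α‖) * ‖f‖ := by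
  set D := ‖ContinuousLinearMap.id ℝ C(Square, ℝ) - L‖
  have hα' : 0 < 1 - ‖α‖ := sub_pos.2 hα
  have : 0 ≤ ‖α‖ * D / (1 - ‖α‖) := by positivity
  calc ‖f - g‖ ≤ ‖f - p‖ + ‖g - p‖ :=
        norm_sub_rev g p ▸ norm_sub_le_norm_sub_add_norm_sub f p g
    _ ≤ ‖f - p‖ + ‖α‖ * D / (1 - ‖α‖) * (‖f - p‖ + ‖f‖) := by
        gcongr
        refine (h.norm_sub_le_mul_norm hα).trans ?_
        gcongr
        exact norm_sub_rev f p ▸ norm_le_norm_sub_add p f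
    _ ≤ E + ‖α‖ * D / (1 - ‖α‖) * (E + ‖f‖) := by gcongr
    _ = (1 + ‖α‖ * (D - 1)) / (1 - ‖α‖) * E + ‖α‖ * D / (1 - ‖α‖) * ‖f‖ := by
        field_simp
        ring

end IsAlphaFractal

end BivariateFractal

theorem mainTheorem10 :
    ∃ C : ℝ, 0 < C ∧
      ∀ (X Y : Grid) (α : C(Square, ℝ)) (hα : ‖α‖ < 1)
        (L : C(Square, ℝ) →L[ℝ] C(Square, ℝ)) (hL : InterpolatesCorners L)
        (m n : ℕ) (_ : 1 ≤ m) (_ : 1 ≤ n) (f : C(Square, ℝ)),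
        approxError (fractalOperator X Y α L hα hL '' polyCoord m n) f ≤
            C * ((1 + ‖α‖ * (‖ContinuousLinearMap.id ℝ C(Square, ℝ) - L‖ - 1)) / (1 - ‖α‖)) *
                modulus 2 f (1 / (m : ℝ)) (1 / (n : ℝ)) +
              ‖α‖ * ‖ContinuousLinearMap.id ℝ C(Square, ℝ) - L‖ / (1 - ‖α‖) * ‖f‖ ∧
        approxError (fractalOperator X Y α L hα hL '' polyTotal m n) f ≤
            C * ((1 + ‖α‖ * (‖ContinuousLinearMap.id ℝ C(Square, ℝ) - L‖ - 1)) / (1 - ‖α‖)) *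
                modulus 2 f (1 / (m : ℝ)) (1 / (n : ℝ)) +
              ‖α‖ * ‖ContinuousLinearMap.id ℝ C(Square, ℝ) - L‖ / (1 - ‖α‖) * ‖f‖ := by
  obtain ⟨C, hC, hjackson⟩ := exists_mem_polyCoord_norm_sub_le
  refine ⟨C, hC, fun X Y α hα L hL m n hm hn f => ?_⟩
  obtain ⟨p, hp, hfp⟩ := hjackson m n hm hn f
  have herror := (isAlphaFractal_fractalOperator X Y α L hα hL p).norm_sub_le_of_approx hα hfp
  rw [mul_left_comm, ← mul_assoc] at herror
  exact ⟨(approxError_le (Set.mem_image_of_mem _ hp)).trans herror,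
    (approxError_le (Set.mem_image_of_mem _ (polyCoord_subset_polyTotal m n hp))).trans herror⟩
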